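/- **Model.** Let a finite directed graph with edge set $E$ be given, together with a set $O$ of origins, a set $D\supseteq O$ of destinations and a set $OD\subseteq O\times D$ of origin–destination pairs. Each $w\in OD$ is served by a nonempty set $P_w$ of directed routes without repeated edges; $\delta_{ep}=1$ if $e\in p$ and $0$ otherwise. For route flows $x$ put $f_e(x)=\sum_{w}\sum_{p\in P_w}\delta_{ep}x_p$. Edge $e$ has a continuous nondecreasing cost $\tau_e:[0,\infty)\to\mathbb R$ with $\tau_e(0)\ge \bar t_e$; $\sigma_e(f)=\int_0^f\tau_e$, $\sigma_e^*(t)=\sup_{f\ge 0}(ft-\sigma_e(f))$, and, for given $\bar f_e$ and $\mu>0$, the function $h_e$ is determined by $\sigma^*_e(t)=\bar f_e(t-\bar t_e)+\mu h_e(t-\bar t_e)$. For demands $s=(s_w)_{w\in OD}\ge0$ let $X(s)=\{x\ge0:\sum_{p\in P_w}x_p=s_w\}$, $\Psi(x)=\sum_e\sigma_e(f_e(x))$, $\Phi(s)=\min_{x\in X(s)}\Psi(x)$, $T_w(t)=\min_{p\in P_w}\sum_e\delta_{ep}t_e$ and $$g(s,t)=\sum_{w}s_wT_w(t)-\langle\bar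 f,t-\bar t\rangle-\mu\sum_e h_e(t_e-\bar t_e).$$ A point $x\in X(s)$ is a Nash–Wardrop equilibrium for $s$ if $x_p>0$, $p\in P_w$, implies $G_p(x)=\min_{p'\in P_w}G_{p'}(x)$, where $G_p(x)=\sum_e\delta_{ep}\tau_e(f_e(x))$. There are $m$ goods, and raw materials available in amounts $b$. Prices are $\lambda^L_i$ ($i\in O$), $\lambda^W_j$ ($j\in D$) for goods and $y$ for raw materials. * Producer $i\in O$ has a compact convex technological set $U_i\subset\mathbb R^m_+$, a fixed cost $\chi_i$, a matrix $A_i\ge0$ of consumption of goods, unit costs $c_i$, a matrix $R_i$ of consumption of materials, and maximizes $\langle\lambda^L_i,L\rangle-\alpha\chi_i-\langle\lambda^W_i,A_iL\rangle-\langle c_i,L\rangle-\langle y,R_iL\rangle$ over $\alpha\in[0,1]$, $L\in\alpha U_i$. * Consumer $j\in D$ has $V_j=\{W\in\mathbb R^m_+:Q_jW\ge\sigma_j\}$, an income $\tau_j$, and maximizes $\beta\tau_j-\langle\lambda^W_j,W\rangle$ over $\beta\in[0,1]$, $W\in\beta V_j$. * The carrier minimizes $C(\lambda,d)+\Phi(s(d))$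 over $d=(d_w)_{w\in OD}$, $d_w\in\mathbb R^m_+$, where $s_w(d)=\sum_k[d_w]_k$, $\gamma\ge0$, and $$C(\lambda,d)=\sum_{i\in O}\Big\langle\lambda^L_i,\sum_{j:(i,j)\in OD}d_{ij}\Big\rangle-\sum_{j\in D}\Big\langle\lambda^W_j,\sum_{i:(i,j)\in OD}d_{ij}\Big\rangle+\gamma\sum_{w}s_w(d)\ln s_w(d).$$ A tuple $(x,d,L,W;y,\lambda^L,\lambda^W)$ is a *full competitive (Walras–Nash–Wardrop–Nesterov–Shikhman) equilibrium* if $L_i$, $W_j$, $d$ solve the problems of all agents, $x$ is a Nash–Wardrop equilibrium for $s(d)$, all prices are nonnegative, and the Walras laws hold: $\sum_{j}d_{ij}\le L_i$ ($i\in O$), $\sum_kd_{ki}\ge W_i+A_iL_i$ ($i\in O$), $\sum_id_{ij}\ge W_j$ ($j\in D\setminus O$), $\sum_iR_iL_i\le b$, with complementary slackness with $\lambda^L_i$, $\lambda^W_i$, $\lambda^W_j$, $y$ respectively. **Productivity.** There are $\bar L_i\in U_i$, $\bar W_j\in V_j$ with $\sum_{i\in O}\bar L_i>\sum_{i\in O}A_i\bar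 L_i+\sum_{j\in D}\bar W_j$ and $\sum_{i\in O}R_i\bar L_i<b$ (componentwise). If $OD\ne O\times D$, assume also that there is a shipment $\bar d\ge0$ on $OD$ with $\sum_{j}\bar d_{ij}\le\bar L_i$ for $i\in O$, $\sum_{i}\bar d_{ij}>\bar W_j+A_j\bar L_j$ for $j\in O$ and $\sum_i\bar d_{ij}>\bar W_j$ for $j\in D\setminus O$ (componentwise). If $\gamma>0$, assume $U_i\not\subseteq\{0\}$ whenever $(i,j)\in OD$ for some $j$. **Theorem.** Under the productivity condition a full competitive equilibrium exists, and it is obtained from the solution of the convex–concave saddle-point problem $$\max_{\lambda^L,\lambda^W,y\ge0}\Big[-\langle y,b\rangle-\sum_{i\in O}\max_{L\in U_i}\big(\langle\lambda^L_i-c_i-A_i^T\lambda^W_i-R_i^Ty,L\rangle-\chi_i\big)_+-\sum_{j\in D}\max_{W\in V_j}\big(\tau_j-\langle\lambda^W_j,W\rangle\big)_++\min_{d\ge0}\Big\{C(\lambda,d)+\max_{t\ge\bar t}g(s(d),t)\Big\}\Big],\qquad(*)$$ where $t$ ranges over $t\ge\bar t$ with all $\sigma_e^*(t_e)$ finite (and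 the minimum over $d$ is read as an infimum in $[-\infty,\infty)$). Precisely, let $F$ be the function obtained by taking all maxima and minima out of the bracket, $$F=-\langle y,b\rangle-\sum_{i}\text{profit}_i(\alpha_i,L_i)-\sum_j(\beta_j\tau_j-\langle\lambda^W_j,W_j\rangle)+C(\lambda,d)+g(s(d),t),$$ minimized over $z=(d,\alpha,L,\beta,W)$ with $d\ge0$, $\alpha_i,\beta_j\in[0,1]$, $L_i\in\alpha_iU_i$, $W_j\in\beta_jV_j$, and maximized over $\xi=(\lambda^L,\lambda^W,y,t)$ with nonnegative prices and $t$ as above. Then: 1. a full competitive equilibrium exists; 2. $F$ is convex in $z$ for every feasible $\xi$ and concave in $\xi$ for every feasible $z$; 3. problem $(*)$ has a solution, and every solution $(\lambda^L,\lambda^W,y)$ of $(*)$ extends, by some $t$ and $z$, to a saddle point of $F$; 4. for every $s\ge0$ the inner maximum over $t$ is attained and equals the transport potential $\Phi(s)$; 5. for every saddle point $(z,\xi)$ of $F$, $\Psi$ has a minimizer on $X(s(d))$, and for each such minimizer $x$ the tuple $(x,d,L,W;y,\lambda^L,\lambda^W)$ is a full competitive equilibrium. -/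

import Mathlib

open scoped Matrix Pointwise

/-- `IsWalk src tgt i j p`: the list of edges `p` is a directed walk from `i` to `j`. -/
def IsWalk {V E : Type*} (src tgt : E → V) : V → V → List E → Prop
  | i, j, [] => i = j
  | i, j, e :: p => src e = i ∧ IsWalk src tgt (tgt e) j p

/-- The data of the model: a transport network on a finite directed (multi)graph, producers at
the origins, consumers at the destinations, and a carrier. There are `m` goods, `q` raw
materials and `r` properties of goods. Families indexed by vertices matter only at the vertices
in `O` (producers) or `D` (consumers); families indexed by pairs matter only on `OD`. -/
structure NetworkMarket (V E : Type*) [Fintype V] [DecidableEq V] [Fintype E] [DecidableEq E]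
    (m q r : ℕ) where
  /-- tail and head of an edge -/
  src : E → V
  tgt : E → V
  /-- origins (producers), destinations (consumers), origin-destination pairs -/
  O : Finset V
  D : Finset V
  OD : Finset (V × V)
  O_subset_D : O ⊆ D
  OD_subset : OD ⊆ O ×ˢ D
  /-- the routes serving a pair: a nonempty set of directed walks without repeated edges -/
  routes : V × V → Finset (List E)
  routes_nonempty : ∀ w ∈ OD, (routes w).Nonempty
  routes_isWalk : ∀ w ∈ OD, ∀ p ∈ routes w, IsWalk src tgt w.1 w.2 p ∧ p.Nodup
  /-- edge costs as functions of the edge flow, on `[0, ∞)` -/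
  τ : E → ℝ → ℝ
  τ_mono : ∀ e, MonotoneOn (τ e) (Set.Ici 0)
  τ_cont : ∀ e, ContinuousOn (τ e) (Set.Ici 0)
  /-- free-flow costs, capacities, and the smoothing parameter of the cost functions -/
  tbar : E → ℝ
  fbar : E → ℝ
  μ : ℝ
  tbar_le : ∀ e, tbar e ≤ τ e 0
  μ_pos : 0 < μ
  /-- weight of the entropy in the problem of the carrier -/
  γ : ℝ
  γ_nonneg : 0 ≤ γ
  /-- producers: technological sets, fixed costs at full participation, consumption of goods,
  unit costs, consumption of raw materials -/
  U : V → Set (Fin m → ℝ)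
  U_compact : ∀ i ∈ O, IsCompact (U i)
  U_convex : ∀ i ∈ O, Convex ℝ (U i)
  U_nonneg : ∀ i ∈ O, ∀ L ∈ U i, 0 ≤ L
  χ : V → ℝ
  A : V → Matrix (Fin m) (Fin m) ℝ
  A_nonneg : ∀ i ∈ O, ∀ k l, 0 ≤ A i k l
  c : V → Fin m → ℝ
  R : V → Matrix (Fin q) (Fin m) ℝ
  /-- available amounts of raw materials -/
  b : Fin q → ℝ
  /-- consumers: property matrices, required levels of the properties, incomes -/
  Q : V → Matrix (Fin r) (Fin m) ℝ
  req : V → Fin r → ℝ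
  inc : V → ℝ

namespace NetworkMarket

noncomputable section

variable {V E : Type*} [Fintype V] [DecidableEq V] [Fintype E] [DecidableEq E] {m q r : ℕ}

/-! Transport subproblem: distribution of given demands `s` over the routes. -/

/-- `δ e p = 1` if the edge `e` lies on the route `p`, and `0` otherwise. -/
def δ (e : E) (p : List E) : ℝ := if e ∈ p then 1 else 0

variable (M : NetworkMarket V E m q r)

/-- The flow on the edge `e` produced by the route flows `x`. -/
def edgeFlow (x : V × V → List E → ℝ) (e : E) : ℝ :=
  ∑ w ∈ M.OD, ∑ p ∈ M.routes w, δ e p * x w p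

/-- The cost of the route `p` under the route flows `x`. -/
def routeCost (x : V × V → List E → ℝ) (p : List E) : ℝ :=
  ∑ e, M.τ e (M.edgeFlow x e) * δ e p

/-- The feasible route flows for the demands `s`. -/
def routeFlows (s : V × V → ℝ) : Set (V × V → List E → ℝ) :=
  {x | ∀ w ∈ M.OD, (∀ p ∈ M.routes w, 0 ≤ x w p) ∧ ∑ p ∈ M.routes w, x w p = s w}

/-- Nash–Wardrop equilibrium for the demands `s`: only cheapest routes are used. -/
def IsNashWardrop (s : V × V → ℝ) (x : V × V → List E → ℝ) : Prop :=
  x ∈ M.routeFlows s ∧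
    ∀ w ∈ M.OD, ∀ p ∈ M.routes w, 0 < x w p → ∀ p' ∈ M.routes w,
      M.routeCost x p ≤ M.routeCost x p'

/-- `σ e f = ∫₀^f τ e`. -/
def σ (e : E) (f : ℝ) : ℝ := ∫ z in (0 : ℝ)..f, M.τ e z

/-- The Beckmann function of the route flows. -/
def Ψ (x : V × V → List E → ℝ) : ℝ := ∑ e, M.σ e (M.edgeFlow x e)

/-- The transport potential of the demands `s`: the minimum of the Beckmann function. -/
def Φ (s : V × V → ℝ) : ℝ := sInf (M.Ψ '' M.routeFlows s)

/-- The domain of the convex conjugate of `σ e`. -/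
def conjDomain (e : E) : Set ℝ := {t | BddAbove ((fun f => f * t - M.σ e f) '' Set.Ici 0)}

/-- The convex conjugate of `σ e` (meaningful on its domain). -/
def σConj (e : E) (t : ℝ) : ℝ := sSup ((fun f => f * t - M.σ e f) '' Set.Ici 0)

/-- The function `h`, determined by the cost function `τ e` through
`σ*(t) = fbar * (t - tbar) + μ * h (t - tbar)`. -/
def h (e : E) (u : ℝ) : ℝ := (M.σConj e (M.tbar e + u) - M.fbar e * u) / M.μ

/-- The length of the shortest route serving `w` for the edge weights `t`. -/
def T (w : V × V) (t : E → ℝ) : ℝ := ⨅ p : {p // p ∈ M.routes w}, ∑ e, δ e p.1 * t e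

/-- The admissible edge weights: `t ≥ tbar`, inside the domain of the conjugates. -/
def weights : Set (E → ℝ) := {t | ∀ e, M.tbar e ≤ t e ∧ t e ∈ M.conjDomain e}

/-- The function maximized over `t` in the inner problem, for the demands `s`. -/
def innerObj (s : V × V → ℝ) (t : E → ℝ) : ℝ :=
  ∑ w ∈ M.OD, s w * M.T w t - ∑ e, M.fbar e * (t e - M.tbar e)
    - M.μ * ∑ e, M.h e (t e - M.tbar e)

/-- The value of the inner problem. -/
def innerMax (s : V × V → ℝ) : ℝ := sSup (M.innerObj s '' M.weights)

/-! Agents. Shipments `d w k` are amounts of the good `k` carried along the pair `w`;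
`pL i` are the prices at the origin `i`, `pW j` those at the destination `j`, and `y` are the
prices of the raw materials. -/

/-- Everything shipped out of `i`. -/
def outflow (d : V × V → Fin m → ℝ) (i : V) : Fin m → ℝ := ∑ w ∈ M.OD with w.1 = i, d w

/-- Everything shipped into `j`. -/
def inflow (d : V × V → Fin m → ℝ) (j : V) : Fin m → ℝ := ∑ w ∈ M.OD with w.2 = j, d w

/-- The total amount (over all goods) shipped along each pair. -/
def total (d : V × V → Fin m → ℝ) (w : V × V) : ℝ := ∑ k, d w k

/-- The consumption bundles admissible at full participation. -/
def consumptionSet (j : V) : Set (Fin m → ℝ) := {W | 0 ≤ W ∧ M.req j ≤ M.Q j *ᵥ W}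

/-- Profit of the producer `i` at participation level `α` and output `L`. -/
def profit (pL pW : V → Fin m → ℝ) (y : Fin q → ℝ) (i : V) (α : ℝ) (L : Fin m → ℝ) : ℝ :=
  pL i ⬝ᵥ L - α * M.χ i - pW i ⬝ᵥ (M.A i *ᵥ L) - M.c i ⬝ᵥ L - y ⬝ᵥ (M.R i *ᵥ L)

/-- `L` solves the problem of the producer `i` (with some participation level). -/
def ProducerOptimal (pL pW : V → Fin m → ℝ) (y : Fin q → ℝ) (i : V) (L : Fin m → ℝ) : Prop :=
  ∃ α ∈ Set.Icc (0 : ℝ) 1, L ∈ α • M.U i ∧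
    ∀ α' ∈ Set.Icc (0 : ℝ) 1, ∀ L' ∈ α' • M.U i,
      M.profit pL pW y i α' L' ≤ M.profit pL pW y i α L

/-- `W` solves the problem of the consumer `j` (with some participation level). -/
def ConsumerOptimal (pW : V → Fin m → ℝ) (j : V) (W : Fin m → ℝ) : Prop :=
  ∃ β ∈ Set.Icc (0 : ℝ) 1, W ∈ β • M.consumptionSet j ∧
    ∀ β' ∈ Set.Icc (0 : ℝ) 1, ∀ W' ∈ β' • M.consumptionSet j,
      β' * M.inc j - pW j ⬝ᵥ W' ≤ β * M.inc j - pW j ⬝ᵥ W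

/-- The nonnegative shipments. -/
def shipments : Set (V × V → Fin m → ℝ) := {d | ∀ w ∈ M.OD, 0 ≤ d w}

/-- The carrier's cost without the transport term: purchases minus sales plus entropy. -/
def tradeCost (pL pW : V → Fin m → ℝ) (d : V × V → Fin m → ℝ) : ℝ :=
  ∑ i ∈ M.O, pL i ⬝ᵥ M.outflow d i - ∑ j ∈ M.D, pW j ⬝ᵥ M.inflow d j
    + M.γ * ∑ w ∈ M.OD, total d w * Real.log (total d w)

/-- `d` solves the problem of the carrier. -/
def CarrierOptimal (pL pW : V → Fin m → ℝ) (d : V × V → Fin m → ℝ) : Prop :=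
  d ∈ M.shipments ∧ ∀ d' ∈ M.shipments,
    M.tradeCost pL pW d + M.Φ (total d) ≤ M.tradeCost pL pW d' + M.Φ (total d')

/-- Prices: at the origins, at the destinations, of the raw materials. -/
abbrev Prices (V : Type*) (m q : ℕ) : Type _ :=
  (V → Fin m → ℝ) × (V → Fin m → ℝ) × (Fin q → ℝ)

/-- The nonnegative prices. -/
def priceSet : Set (Prices V m q) :=
  {π | (∀ i ∈ M.O, 0 ≤ π.1 i) ∧ (∀ j ∈ M.D, 0 ≤ π.2.1 j) ∧ 0 ≤ π.2.2}

/-- The Walras laws: nonnegative prices, balance inequalities, complementary slackness. -/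
structure WalrasLaws (d : V × V → Fin m → ℝ) (L W : V → Fin m → ℝ) (π : Prices V m q) :
    Prop where
  prices_nonneg : π ∈ M.priceSet
  origin_le : ∀ i ∈ M.O, M.outflow d i ≤ L i
  origin_slack : ∀ i ∈ M.O, π.1 i ⬝ᵥ (M.outflow d i - L i) = 0
  producer_le : ∀ i ∈ M.O, W i + M.A i *ᵥ L i ≤ M.inflow d i
  producer_slack : ∀ i ∈ M.O, π.2.1 i ⬝ᵥ (W i + M.A i *ᵥ L i - M.inflow d i) = 0
  consumer_le : ∀ j ∈ M.D \ M.O, W j ≤ M.inflow d j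
  consumer_slack : ∀ j ∈ M.D \ M.O, π.2.1 j ⬝ᵥ (W j - M.inflow d j) = 0
  material_le : ∑ i ∈ M.O, M.R i *ᵥ L i ≤ M.b
  material_slack : π.2.2 ⬝ᵥ (M.b - ∑ i ∈ M.O, M.R i *ᵥ L i) = 0

/-- Competitive (Walras–Nesterov–Shikhman) equilibrium: all agents solve their problems and the
Walras laws hold. -/
structure IsCompetitiveEquilibrium (d : V × V → Fin m → ℝ) (L W : V → Fin m → ℝ)
    (π : Prices V m q) : Prop where
  producers : ∀ i ∈ M.O, M.ProducerOptimal π.1 π.2.1 π.2.2 i (L i)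
  consumers : ∀ j ∈ M.D, M.ConsumerOptimal π.2.1 j (W j)
  carrier : M.CarrierOptimal π.1 π.2.1 d
  walras : M.WalrasLaws d L W π

/-- Full competitive (Walras–Nash–Wardrop–Nesterov–Shikhman) equilibrium. -/
structure IsFullEquilibrium (x : V × V → List E → ℝ) (d : V × V → Fin m → ℝ)
    (L W : V → Fin m → ℝ) (π : Prices V m q) : Prop where
  competitive : M.IsCompetitiveEquilibrium d L W π
  wardrop : M.IsNashWardrop (total d) x

/-! Productivity. -/

/-- A productive plan: in the aggregate, strictly more of every good is produced than is used in
production and consumed, and strictly less of every raw material is used than is available. -/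
structure IsProductivePlan (L W : V → Fin m → ℝ) : Prop where
  mem_U : ∀ i ∈ M.O, L i ∈ M.U i
  mem_V : ∀ j ∈ M.D, W j ∈ M.consumptionSet j
  goods : ∀ k, (∑ i ∈ M.O, M.A i *ᵥ L i + ∑ j ∈ M.D, W j) k < (∑ i ∈ M.O, L i) k
  materials : ∀ k, (∑ i ∈ M.O, M.R i *ᵥ L i) k < M.b k

/-- The plan can be shipped. Nothing is required if every origin serves every destination;
otherwise some shipment along the pairs in `OD` must strictly cover the needs of every
destination. -/
def IsShippable (L W : V → Fin m → ℝ) : Prop :=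
  M.OD = M.O ×ˢ M.D ∨
    ∃ d ∈ M.shipments, (∀ i ∈ M.O, M.outflow d i ≤ L i) ∧
      ∀ j ∈ M.D, ∀ k, (W j + if j ∈ M.O then M.A j *ᵥ L j else 0) k < M.inflow d j k

/-! The saddle-point problem. -/

/-- `max_{L ∈ U_i} (⟨pL_i - c_i - A_iᵀ pW_i - R_iᵀ y, L⟩ - χ_i)₊`. -/
def producerMax (π : Prices V m q) (i : V) : ℝ :=
  sSup ((fun L => max ((π.1 i - M.c i - (M.A i)ᵀ *ᵥ π.2.1 i - (M.R i)ᵀ *ᵥ π.2.2) ⬝ᵥ L - M.χ i) 0)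
    '' M.U i)

/-- `max_{W ∈ V_j} (inc_j - ⟨pW_j, W⟩)₊`. -/
def consumerMax (π : Prices V m q) (j : V) : ℝ :=
  sSup ((fun W => max (M.inc j - π.2.1 j ⬝ᵥ W) 0) '' M.consumptionSet j)

/-- The function of the prices that is maximized in the outer problem. Its last term is the
minimum over the shipments of an expression that contains the inner maximum over `t`; for some
prices it may be `-∞`. -/
def outerObj (π : Prices V m q) : EReal :=
  ((-(π.2.2 ⬝ᵥ M.b) - ∑ i ∈ M.O, M.producerMax π i - ∑ j ∈ M.D, M.consumerMax π j : ℝ) : EReal)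
    + ⨅ d ∈ M.shipments, ((M.tradeCost π.1 π.2.1 d + M.innerMax (total d) : ℝ) : EReal)

/-- `π` is a solution of the outer problem: it maximizes `outerObj` over nonnegative prices. -/
def IsOuterSolution (π : Prices V m q) : Prop :=
  π ∈ M.priceSet ∧ IsMaxOn M.outerObj M.priceSet π

/-- The variables of the minimization `(d, (α, L), (β, W))`: shipments, participation levels and
outputs of the producers, participation levels and bundles of the consumers. -/
abbrev Plan (V : Type*) (m : ℕ) : Type _ :=
  (V × V → Fin m → ℝ) × ((V → ℝ) × (V → Fin m → ℝ)) × ((V → ℝ) × (V → Fin m → ℝ))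

/-- The feasible plans. -/
def planSet : Set (Plan V m) :=
  {z | z.1 ∈ M.shipments ∧
    (∀ i ∈ M.O, z.2.1.1 i ∈ Set.Icc (0 : ℝ) 1 ∧ z.2.1.2 i ∈ z.2.1.1 i • M.U i) ∧
    (∀ j ∈ M.D, z.2.2.1 j ∈ Set.Icc (0 : ℝ) 1 ∧ z.2.2.2 j ∈ z.2.2.1 j • M.consumptionSet j)}

/-- The variables of the maximization: nonnegative prices and admissible edge weights. -/
def dualSet : Set (Prices V m q × (E → ℝ)) := M.priceSet ×ˢ M.weights

/-- The function obtained when all maxima and minima of the outer problem are taken out of the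
bracket: minus profits of producers, minus surpluses of consumers, plus the carrier's cost. -/
def saddleFun (z : Plan V m) (ξ : Prices V m q × (E → ℝ)) : ℝ :=
  -(ξ.1.2.2 ⬝ᵥ M.b)
    - ∑ i ∈ M.O, M.profit ξ.1.1 ξ.1.2.1 ξ.1.2.2 i (z.2.1.1 i) (z.2.1.2 i)
    - ∑ j ∈ M.D, (z.2.2.1 j * M.inc j - ξ.1.2.1 j ⬝ᵥ z.2.2.2 j)
    + (M.tradeCost ξ.1.1 ξ.1.2.1 z.1 + M.innerObj (total z.1) ξ.2)

end

end NetworkMarket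

namespace NetworkMarket

open Filter Topology

set_option linter.unusedSectionVars false

variable {V E : Type*} [Fintype V] [DecidableEq V] [Fintype E] [DecidableEq E] {m q r : ℕ}
variable (M : NetworkMarket V E m q r)

/-! ### Edge costs -/

/-! The equilibrium is a decentralized optimum of one convex program: minimize the social cost
`cost` (production cost minus incomes plus entropy plus the transport potential `Φ`) over plans
satisfying the balance inequalities `IsBalanced`. Collecting the terms of `saddleFun` by price gives
`baseCost + pairing + innerObj` (`saddleFun_eq`). Maximizing over the weights turns the last summand
into `Φ` by Fenchel duality on the network, so `(*)` is the Lagrange dual of this program and the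
prices are the multipliers.

A balanced optimal plan exists by compactness (`exists_optimal_plan`), and `exists_prices` provides
multipliers with no duality gap. Separation needs a Slater point, but a good that is never produced
at an origin makes the constraint there an equality. Separation is therefore done over
`restrictedPlans`, which do not ship such goods. Pricing these goods high enough then extends the
bound to all plans: replacing or dropping the forbidden shipments does not raise the Lagrangian.

The weights must be chosen before the plan varies, although `weights` need not be compact. They are
the edge costs at a Beckmann minimizer for the optimal demands. The corresponding affine minorant of
`Φ` is exact to first order along segments (`exists_tangent_weights`), so optimality for the
Lagrangian passes to the saddle function by convexity (`exists_isSaddlePointOn`).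

Conversely, at a saddle point the maximization over the price cone yields the Walras laws, while the
minimization separates into the problems of the agents
(`isCompetitiveEquilibrium_of_isSaddlePointOn`). Beckmann minimizers satisfy the Wardrop condition
through their first-order condition. -/

theorem intervalIntegrable_τ (e : E) {a b : ℝ} (ha : 0 ≤ a) (hb : 0 ≤ b) :
    IntervalIntegrable (M.τ e) MeasureTheory.volume a b :=
  ((M.τ_cont e).mono fun _ hz => le_trans (le_min ha hb) hz.1).intervalIntegrable

theorem σ_sub (e : E) {a b : ℝ} (ha : 0 ≤ a) (hb : 0 ≤ b) :
    M.σ e b - M.σ e a = ∫ z in a..b, M.τ e z :=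
  intervalIntegral.integral_interval_sub_left (M.intervalIntegrable_τ e le_rfl hb)
    (M.intervalIntegrable_τ e le_rfl ha)

/-- Monotonicity of `τ e` bounds the integrand by its value at `b`, from above or from below
according to the order of `a` and `b`. Thus `τ e b` is a subgradient of `σ e` at `b`; convexity of
`σ e` enters below in this form. -/
theorem σ_sub_le (e : E) {a b : ℝ} (ha : 0 ≤ a) (hb : 0 ≤ b) :
    M.σ e b - M.σ e a ≤ (b - a) * M.τ e b := by
  rcases le_total a b with hab | hab
  · rw [M.σ_sub e ha hb]
    calc ∫ z in a..b, M.τ e z ≤ ∫ _ in a..b, M.τ e b :=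
          intervalIntegral.integral_mono_on hab (M.intervalIntegrable_τ e ha hb) (by simp)
            fun z hz => M.τ_mono e (ha.trans hz.1) hb hz.2
      _ = _ := by simp
  · have h : ∫ _ in b..a, M.τ e b ≤ ∫ z in b..a, M.τ e z :=
      intervalIntegral.integral_mono_on hab (by simp) (M.intervalIntegrable_τ e hb ha)
        fun z hz => M.τ_mono e hb (hb.trans hz.1) hz.1
    rw [← M.σ_sub e hb ha] at h
    simp only [intervalIntegral.integral_const, smul_eq_mul] at h
    linarith

theorem continuousOn_σ (e : E) : ContinuousOn (M.σ e) (Set.Ici 0) := by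
  have hc : Continuous fun z => M.τ e (max z 0) :=
    (M.τ_cont e).comp_continuous (by fun_prop) fun z => Set.mem_Ici.2 (le_max_right _ _)
  refine (intervalIntegral.continuous_primitive (μ := MeasureTheory.volume)
    (fun a b => hc.intervalIntegrable a b) 0).continuousOn.congr fun f hf => ?_
  refine intervalIntegral.integral_congr fun z hz => ?_
  rw [Set.uIcc_of_le hf] at hz
  simp [max_eq_left hz.1]

theorem tbar_le_τ (e : E) {f : ℝ} (hf : 0 ≤ f) : M.tbar e ≤ M.τ e f :=
  (M.tbar_le e).trans (M.τ_mono e (Set.mem_Ici.2 le_rfl) hf hf)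

/-- This is Fenchel's equality at a subgradient. It makes the edge costs of any nonnegative flow
admissible weights, with an explicit conjugate. -/
theorem τ_isGreatest (e : E) {f : ℝ} (hf : 0 ≤ f) :
    IsGreatest ((fun g => g * M.τ e f - M.σ e g) '' Set.Ici 0) (f * M.τ e f - M.σ e f) := by
  refine ⟨⟨f, hf, rfl⟩, ?_⟩
  rintro _ ⟨g, hg, rfl⟩
  have := M.σ_sub_le e hg hf
  dsimp only
  linarith

theorem τ_mem_conjDomain (e : E) {f : ℝ} (hf : 0 ≤ f) : M.τ e f ∈ M.conjDomain e :=
  (M.τ_isGreatest e hf).bddAbove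

theorem σConj_τ (e : E) {f : ℝ} (hf : 0 ≤ f) : M.σConj e (M.τ e f) = f * M.τ e f - M.σ e f :=
  (M.τ_isGreatest e hf).csSup_eq

theorem le_σConj (e : E) {f t : ℝ} (hf : 0 ≤ f) (ht : t ∈ M.conjDomain e) :
    f * t - M.σ e f ≤ M.σConj e t :=
  le_csSup ht ⟨f, hf, rfl⟩

theorem convexOn_σConj (e : E) : ConvexOn ℝ (M.conjDomain e) (M.σConj e) := by
  -- One bound serves twice: it shows that the domain is convex and that the supremum of affine
  -- functions is convex there.
  have key : ∀ ⦃t⦄, t ∈ M.conjDomain e → ∀ ⦃u⦄, u ∈ M.conjDomain e → ∀ ⦃a b : ℝ⦄, 0 ≤ a → 0 ≤ b →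
      a + b = 1 → a * M.σConj e t + b * M.σConj e u ∈
        upperBounds ((fun f => f * (a * t + b * u) - M.σ e f) '' Set.Ici 0) := by
    rintro t ht u hu a b ha hb hab _ ⟨f, hf, rfl⟩
    have h1 := mul_le_mul_of_nonneg_left (M.le_σConj e hf ht) ha
    have h2 := mul_le_mul_of_nonneg_left (M.le_σConj e hf hu) hb
    have h3 : M.σ e f = a * M.σ e f + b * M.σ e f := by rw [← add_mul, hab, one_mul]
    dsimp only
    linarith
  refine ⟨fun t ht u hu a b ha hb hab => ⟨_, key ht hu ha hb hab⟩, ?_⟩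
  intro t ht u hu a b ha hb hab
  exact csSup_le ⟨_, 0, Set.mem_Ici.2 le_rfl, rfl⟩ (key ht hu ha hb hab)

theorem convex_weights : Convex ℝ M.weights := by
  intro t ht u hu a b ha hb hab e
  refine ⟨?_, (M.convexOn_σConj e).1 (ht e).2 (hu e).2 ha hb hab⟩
  have h1 := mul_le_mul_of_nonneg_left (ht e).1 ha
  have h2 := mul_le_mul_of_nonneg_left (hu e).1 hb
  have h3 : M.tbar e = a * M.tbar e + b * M.tbar e := by rw [← add_mul, hab, one_mul]
  simp only [Pi.add_apply, Pi.smul_apply, smul_eq_mul]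
  linarith

/-! ### Shortest routes -/

/-- The length of the route `p` for the edge weights `t`. -/
def length (t : E → ℝ) (p : List E) : ℝ := ∑ e, δ e p * t e

theorem T_le {w : V × V} {p : List E} (hp : p ∈ M.routes w) (t : E → ℝ) :
    M.T w t ≤ length t p :=
  ciInf_le (Set.finite_range _).bddBelow (⟨p, hp⟩ : {p // p ∈ M.routes w})

theorem exists_T_eq {w : V × V} (hw : w ∈ M.OD) (t : E → ℝ) :
    ∃ p ∈ M.routes w, M.T w t = length t p := by
  obtain ⟨p₀, hp₀⟩ := M.routes_nonempty w hw
  have : Nonempty {p // p ∈ M.routes w} := ⟨⟨p₀, hp₀⟩⟩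
  obtain ⟨p, hp⟩ := exists_eq_ciInf_of_finite
    (f := fun p : {p // p ∈ M.routes w} => ∑ e, δ e p.1 * t e)
  exact ⟨p.1, p.2, hp.symm⟩

theorem le_T {w : V × V} (hw : w ∈ M.OD) {t : E → ℝ} {a : ℝ}
    (h : ∀ p ∈ M.routes w, a ≤ length t p) : a ≤ M.T w t := by
  obtain ⟨p, hp, h'⟩ := M.exists_T_eq hw t
  exact h' ▸ h p hp

theorem length_combo (t u : E → ℝ) (a b : ℝ) (p : List E) :
    length (a • t + b • u) p = a * length t p + b * length u p := by
  simp only [length, Finset.mul_sum, ← Finset.sum_add_distrib]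
  refine Finset.sum_congr rfl fun e _ => ?_
  simp only [Pi.add_apply, Pi.smul_apply, smul_eq_mul]
  ring

theorem T_combo_ge {w : V × V} (hw : w ∈ M.OD) (t u : E → ℝ) {a b : ℝ} (ha : 0 ≤ a) (hb : 0 ≤ b) :
    a * M.T w t + b * M.T w u ≤ M.T w (a • t + b • u) := by
  refine M.le_T hw fun p hp => ?_
  rw [length_combo]
  exact add_le_add (mul_le_mul_of_nonneg_left (M.T_le hp t) ha)
    (mul_le_mul_of_nonneg_left (M.T_le hp u) hb)

theorem δ_nonneg (e : E) (p : List E) : 0 ≤ δ e p := by unfold δ; split_ifs <;> norm_num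

theorem δ_le_one (e : E) (p : List E) : δ e p ≤ 1 := by unfold δ; split_ifs <;> norm_num

/-- Free-flow costs may be negative, so route lengths need not be nonnegative. This uniform lower
bound is what limits the growth of `Φ` when demand is removed. -/
theorem T_ge_of_weights {w : V × V} (hw : w ∈ M.OD) {t : E → ℝ} (ht : t ∈ M.weights) :
    -∑ e, |M.tbar e| ≤ M.T w t := by
  refine M.le_T hw fun p _ => ?_
  rw [length, ← Finset.sum_neg_distrib]
  refine Finset.sum_le_sum fun e _ => ?_
  have h0 := δ_nonneg e p
  have h1 := δ_le_one e p
  have h2 := (ht e).1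
  have h3 := neg_abs_le (M.tbar e)
  have h4 := abs_nonneg (M.tbar e)
  nlinarith [mul_le_mul_of_nonneg_left (h3.trans h2) h0]

/-! ### Route flows -/

theorem edgeFlow_nonneg {s : V × V → ℝ} {x : V × V → List E → ℝ} (hx : x ∈ M.routeFlows s) (e : E) :
    0 ≤ M.edgeFlow x e :=
  Finset.sum_nonneg fun w hw => Finset.sum_nonneg fun p hp =>
    mul_nonneg (δ_nonneg e p) ((hx w hw).1 p hp)

theorem edgeFlow_combo (x x' : V × V → List E → ℝ) (a b : ℝ) (e : E) :
    M.edgeFlow (a • x + b • x') e = a * M.edgeFlow x e + b * M.edgeFlow x' e := by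
  simp only [edgeFlow, Finset.mul_sum, ← Finset.sum_add_distrib]
  refine Finset.sum_congr rfl fun w _ => Finset.sum_congr rfl fun p _ => ?_
  simp only [Pi.add_apply, Pi.smul_apply, smul_eq_mul]
  ring

theorem sum_edgeFlow_mul (x : V × V → List E → ℝ) (t : E → ℝ) :
    ∑ e, M.edgeFlow x e * t e = ∑ w ∈ M.OD, ∑ p ∈ M.routes w, x w p * length t p := by
  simp only [edgeFlow, length, Finset.sum_mul, Finset.mul_sum]
  rw [Finset.sum_comm]
  refine Finset.sum_congr rfl fun w _ => ?_
  rw [Finset.sum_comm]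
  refine Finset.sum_congr rfl fun p _ => Finset.sum_congr rfl fun e _ => by ring

theorem routeFlows_combo {s s' : V × V → ℝ} {x x' : V × V → List E → ℝ} (hx : x ∈ M.routeFlows s)
    (hx' : x' ∈ M.routeFlows s') {a b : ℝ} (ha : 0 ≤ a) (hb : 0 ≤ b) :
    a • x + b • x' ∈ M.routeFlows (a • s + b • s') := by
  refine fun w hw => ⟨fun p hp => ?_, ?_⟩
  · exact add_nonneg (mul_nonneg ha ((hx w hw).1 p hp)) (mul_nonneg hb ((hx' w hw).1 p hp))
  · simp only [Pi.add_apply, Pi.smul_apply, smul_eq_mul, Finset.sum_add_distrib, ← Finset.mul_sum,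
      (hx w hw).2, (hx' w hw).2]

/-- The demands `s` can be routed along shortest routes. -/
theorem exists_shortest_flow {s : V × V → ℝ} (hs : ∀ w ∈ M.OD, 0 ≤ s w) (t : E → ℝ) :
    ∃ x ∈ M.routeFlows s, ∑ e, M.edgeFlow x e * t e = ∑ w ∈ M.OD, s w * M.T w t := by
  classical
  have h : ∀ w, ∃ p, w ∈ M.OD → p ∈ M.routes w ∧ M.T w t = length t p := fun w => by
    by_cases hw : w ∈ M.OD
    · obtain ⟨p, hp⟩ := M.exists_T_eq hw t
      exact ⟨p, fun _ => hp⟩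
    · exact ⟨[], fun h => absurd h hw⟩
  choose P hP using h
  refine ⟨fun w p => if p = P w then s w else 0, fun w hw => ⟨fun p _ => ?_, ?_⟩, ?_⟩
  · dsimp only
    split_ifs
    exacts [hs w hw, le_rfl]
  · rw [Finset.sum_ite_eq', if_pos (hP w hw).1]
  · rw [sum_edgeFlow_mul]
    refine Finset.sum_congr rfl fun w hw => ?_
    simp only [ite_mul, zero_mul]
    rw [Finset.sum_ite_eq', if_pos (hP w hw).1, (hP w hw).2]

/-! ### The Beckmann function and Nash–Wardrop equilibria -/

theorem Ψ_le_add {s s' : V × V → ℝ} {x x' : V × V → List E → ℝ} (hx : x ∈ M.routeFlows s)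
    (hx' : x' ∈ M.routeFlows s') :
    M.Ψ x' ≤ M.Ψ x + ∑ e, (M.edgeFlow x' e - M.edgeFlow x e) * M.τ e (M.edgeFlow x' e) := by
  rw [Ψ, Ψ, ← Finset.sum_add_distrib]
  refine Finset.sum_le_sum fun e _ => ?_
  have := M.σ_sub_le e (M.edgeFlow_nonneg hx e) (M.edgeFlow_nonneg hx' e)
  linarith

theorem continuousOn_Ψ (s : V × V → ℝ) : ContinuousOn M.Ψ (M.routeFlows s) := by
  refine continuousOn_finsetSum _ fun e _ => ?_
  refine (M.continuousOn_σ e).comp (Continuous.continuousOn ?_) fun x hx => M.edgeFlow_nonneg hx e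
  unfold edgeFlow
  fun_prop

/-- The Beckmann function has a minimizer. -/
theorem exists_isMinOn_Ψ {s : V × V → ℝ} (hs : ∀ w ∈ M.OD, 0 ≤ s w) :
    ∃ x ∈ M.routeFlows s, IsMinOn M.Ψ (M.routeFlows s) x := by
  classical
  -- Coordinates off `OD` or off the routes are unconstrained in `routeFlows`. The box pins them to
  -- zero, which changes no edge flow; Tychonoff's theorem copes with the possibly infinite type of
  -- lists.
  let box : Set (V × V → List E → ℝ) := Set.univ.pi fun w => Set.univ.pi fun p =>
    if w ∈ M.OD ∧ p ∈ M.routes w then Set.Icc 0 (s w) else {0}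
  have hbox : IsCompact box := isCompact_univ_pi fun w => isCompact_univ_pi fun p => by
    split_ifs
    exacts [isCompact_Icc, isCompact_singleton]
  have hclosed : IsClosed {x : V × V → List E → ℝ | ∀ w ∈ M.OD, ∑ p ∈ M.routes w, x w p = s w} := by
    simp only [Set.ofPred_forall]
    exact isClosed_biInter fun w _ => isClosed_eq (by fun_prop) continuous_const
  set K := box ∩ {x : V × V → List E → ℝ | ∀ w ∈ M.OD, ∑ p ∈ M.routes w, x w p = s w} with hK
  have hKsub : K ⊆ M.routeFlows s := by
    refine fun x hx w hw => ⟨fun p hp => ?_, hx.2 w hw⟩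
    have h := hx.1 w trivial p trivial
    simp only [hw, hp, and_self, if_true] at h
    exact h.1
  let trunc : (V × V → List E → ℝ) → V × V → List E → ℝ := fun x w p =>
    if w ∈ M.OD ∧ p ∈ M.routes w then x w p else 0
  have hflow : ∀ x, M.edgeFlow (trunc x) = M.edgeFlow x := fun x => by
    funext e
    refine Finset.sum_congr rfl fun w hw => Finset.sum_congr rfl fun p hp => ?_
    simp [trunc, hw, hp]
  have htrunc : ∀ x ∈ M.routeFlows s, trunc x ∈ K := by
    intro x hx
    refine ⟨fun w _ p _ => ?_, fun w hw => ?_⟩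
    · by_cases h : w ∈ M.OD ∧ p ∈ M.routes w
      · simp only [trunc, h, and_self, if_true]
        refine ⟨(hx w h.1).1 p h.2, ?_⟩
        rw [← (hx w h.1).2]
        exact Finset.single_le_sum (f := fun p => x w p) (fun p hp => (hx w h.1).1 p hp) h.2
      · simp [trunc, h]
    · rw [← (hx w hw).2]
      exact Finset.sum_congr rfl fun p hp => by simp [trunc, hw, hp]
  obtain ⟨x₀, hx₀, -⟩ := M.exists_shortest_flow hs 0
  obtain ⟨x, hxK, hmin⟩ := (hbox.inter_right hclosed).exists_isMinOn ⟨_, htrunc x₀ hx₀⟩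
    ((M.continuousOn_Ψ s).mono hKsub)
  refine ⟨x, hKsub hxK, fun x' hx' => ?_⟩
  have h := hmin (htrunc x' hx')
  simp only [Set.mem_ofPred_eq, Ψ, hflow] at h ⊢
  exact h

theorem Φ_eq_of_isMinOn {s : V × V → ℝ} {x : V × V → List E → ℝ} (hx : x ∈ M.routeFlows s)
    (hmin : IsMinOn M.Ψ (M.routeFlows s) x) : M.Φ s = M.Ψ x :=
  IsLeast.csInf_eq ⟨⟨x, hx, rfl⟩, by rintro _ ⟨y, hy, rfl⟩; exact hmin hy⟩

theorem Φ_le {s : V × V → ℝ} (hs : ∀ w ∈ M.OD, 0 ≤ s w) {x : V × V → List E → ℝ}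
    (hx : x ∈ M.routeFlows s) : M.Φ s ≤ M.Ψ x := by
  obtain ⟨x', hx', hmin⟩ := M.exists_isMinOn_Ψ hs
  rw [M.Φ_eq_of_isMinOn hx' hmin]
  exact hmin hx

theorem tendsto_τ_combo {s s' : V × V → ℝ} {x x' : V × V → List E → ℝ} (hx : x ∈ M.routeFlows s)
    (hx' : x' ∈ M.routeFlows s') (e : E) :
    Tendsto (fun ε : ℝ => M.τ e (M.edgeFlow ((1 - ε) • x + ε • x') e)) (𝓝[Set.Ioc 0 1] 0)
      (𝓝 (M.τ e (M.edgeFlow x e))) := by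
  refine ((M.τ_cont e) _ (M.edgeFlow_nonneg hx e)).tendsto.comp (tendsto_nhdsWithin_iff.2 ⟨?_, ?_⟩)
  · have h : Tendsto (fun ε : ℝ => (1 - ε) * M.edgeFlow x e + ε * M.edgeFlow x' e) (𝓝 0)
        (𝓝 ((1 - 0) * M.edgeFlow x e + 0 * M.edgeFlow x' e)) :=
      Continuous.tendsto (by fun_prop) 0
    simp only [edgeFlow_combo]
    simpa using h.mono_left nhdsWithin_le_nhds
  · refine eventually_nhdsWithin_of_forall fun ε hε => ?_
    exact M.edgeFlow_nonneg (M.routeFlows_combo hx hx' (sub_nonneg.2 hε.2) hε.1.le) e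

instance neBot_nhdsWithin_Ioc : (𝓝[Set.Ioc (0 : ℝ) 1] 0).NeBot := by
  rw [nhdsWithin_Ioc_eq_nhdsGT one_pos]
  infer_instance

/-- The slope is taken at the moved point, where the subgradient inequality gives an upper bound.
Continuity of `τ` recovers the derivative at `x` as `ε → 0`. -/
theorem Ψ_combo_le {s s' : V × V → ℝ} {x x' : V × V → List E → ℝ} (hx : x ∈ M.routeFlows s)
    (hx' : x' ∈ M.routeFlows s') {ε : ℝ} (hε : ε ∈ Set.Ioc (0 : ℝ) 1) :
    M.Ψ ((1 - ε) • x + ε • x') ≤ M.Ψ x + ε * ∑ e, (M.edgeFlow x' e - M.edgeFlow x e) *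
      M.τ e (M.edgeFlow ((1 - ε) • x + ε • x') e) := by
  refine (M.Ψ_le_add hx (M.routeFlows_combo hx hx' (sub_nonneg.2 hε.2) hε.1.le)).trans_eq ?_
  rw [Finset.mul_sum]
  congr 1
  refine Finset.sum_congr rfl fun e _ => ?_
  have h := M.edgeFlow_combo x x' (1 - ε) ε e
  rw [show M.edgeFlow ((1 - ε) • x + ε • x') e - M.edgeFlow x e
    = ε * (M.edgeFlow x' e - M.edgeFlow x e) by rw [h]; ring]
  ring

/-- The variational inequality satisfied by a minimizer of the Beckmann function. -/
theorem variational_inequality {s : V × V → ℝ} {x x' : V × V → List E → ℝ}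
    (hx : x ∈ M.routeFlows s) (hmin : IsMinOn M.Ψ (M.routeFlows s) x) (hx' : x' ∈ M.routeFlows s) :
    ∑ e, M.edgeFlow x e * M.τ e (M.edgeFlow x e) ≤
      ∑ e, M.edgeFlow x' e * M.τ e (M.edgeFlow x e) := by
  have hlim := tendsto_finsetSum Finset.univ fun e _ =>
    (M.tendsto_τ_combo hx hx' e).const_mul (M.edgeFlow x' e - M.edgeFlow x e)
  have hpos : ∀ᶠ ε : ℝ in 𝓝[Set.Ioc 0 1] 0, 0 ≤ ∑ e, (M.edgeFlow x' e - M.edgeFlow x e) *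
      M.τ e (M.edgeFlow ((1 - ε) • x + ε • x') e) := by
    refine eventually_nhdsWithin_of_forall fun ε hε => ?_
    have h1 := M.Ψ_combo_le hx hx' hε
    have h2 : (1 - ε) • x + ε • x' ∈ M.routeFlows s := by
      have := M.routeFlows_combo hx hx' (sub_nonneg.2 hε.2) hε.1.le
      rwa [← add_smul, sub_add_cancel, one_smul] at this
    have h3 : M.Ψ x ≤ M.Ψ ((1 - ε) • x + ε • x') := hmin h2
    exact nonneg_of_mul_nonneg_right (by linarith) hε.1
  have h := ge_of_tendsto hlim hpos
  simp only [sub_mul, Finset.sum_sub_distrib] at h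
  linarith

theorem sum_T_le {s : V × V → ℝ} {x : V × V → List E → ℝ} (hx : x ∈ M.routeFlows s) (t : E → ℝ) :
    ∑ w ∈ M.OD, s w * M.T w t ≤ ∑ e, M.edgeFlow x e * t e := by
  rw [sum_edgeFlow_mul]
  refine Finset.sum_le_sum fun w hw => ?_
  rw [← (hx w hw).2, Finset.sum_mul]
  exact Finset.sum_le_sum fun p hp => mul_le_mul_of_nonneg_left (M.T_le hp t) ((hx w hw).1 p hp)

/-- The variational inequality is tested against the flow that sends every demand along a shortest
route for the current edge costs. -/
theorem sum_T_eq {s : V × V → ℝ} (hs : ∀ w ∈ M.OD, 0 ≤ s w) {x : V × V → List E → ℝ}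
    (hx : x ∈ M.routeFlows s) (hmin : IsMinOn M.Ψ (M.routeFlows s) x) :
    ∑ w ∈ M.OD, s w * M.T w (fun e => M.τ e (M.edgeFlow x e)) =
      ∑ e, M.edgeFlow x e * M.τ e (M.edgeFlow x e) := by
  refine le_antisymm (M.sum_T_le hx _) ?_
  obtain ⟨x', hx', h⟩ := M.exists_shortest_flow hs fun e => M.τ e (M.edgeFlow x e)
  exact h ▸ M.variational_inequality hx hmin hx'

/-- By `sum_T_eq` the nonnegative slacks `x w p * (length t p - T w t)` sum to zero, so each
vanishes and a used route has shortest length. -/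
theorem isNashWardrop_of_isMinOn {s : V × V → ℝ} {x : V × V → List E → ℝ}
    (hx : x ∈ M.routeFlows s) (hmin : IsMinOn M.Ψ (M.routeFlows s) x) : M.IsNashWardrop s x := by
  refine ⟨hx, fun w hw p hp hxp p' hp' => ?_⟩
  have hs : ∀ w ∈ M.OD, 0 ≤ s w := fun w hw => by
    rw [← (hx w hw).2]
    exact Finset.sum_nonneg (hx w hw).1
  set t : E → ℝ := fun e => M.τ e (M.edgeFlow x e) with ht
  have hcost : ∀ p, M.routeCost x p = length t p := fun p =>
    Finset.sum_congr rfl fun e _ => mul_comm _ _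
  have h := M.sum_T_eq hs hx hmin
  rw [← ht, M.sum_edgeFlow_mul x t] at h
  have h1 : ∀ w ∈ M.OD, ∀ p ∈ M.routes w, x w p * M.T w t ≤ x w p * length t p := fun w hw p hp =>
    mul_le_mul_of_nonneg_left (M.T_le hp t) ((hx w hw).1 p hp)
  have h2 : ∀ w ∈ M.OD, s w * M.T w t = ∑ p ∈ M.routes w, x w p * M.T w t := fun w hw => by
    rw [← (hx w hw).2, Finset.sum_mul]
  rw [Finset.sum_congr rfl h2, Finset.sum_eq_sum_iff_of_le
    fun w hw => Finset.sum_le_sum (h1 w hw)] at h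
  have h3 := (Finset.sum_eq_sum_iff_of_le (h1 w hw)).1 (h w hw) p hp
  rw [hcost, hcost, ← mul_left_cancel₀ hxp.ne' h3]
  exact M.T_le hp' t

/-! ### The inner problem -/

/-- The capacities and `μ` cancel against the definition of `h`. This is pure algebra and holds for
all `t`, also outside the domain of the conjugates. -/
theorem innerObj_eq (s : V × V → ℝ) (t : E → ℝ) :
    M.innerObj s t = ∑ w ∈ M.OD, s w * M.T w t - ∑ e, M.σConj e (t e) := by
  have hμ : M.μ ≠ 0 := M.μ_pos.ne'
  have : M.μ * ∑ e, M.h e (t e - M.tbar e)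
      = ∑ e, M.σConj e (t e) - ∑ e, M.fbar e * (t e - M.tbar e) := by
    rw [Finset.mul_sum, ← Finset.sum_sub_distrib]
    refine Finset.sum_congr rfl fun e _ => ?_
    rw [h, add_sub_cancel]
    field_simp
  rw [innerObj, this]
  ring

/-- Weak duality: Fenchel–Young on every edge, and shortest routes cost no more than the routes in
use. -/
theorem innerObj_le_Ψ {s : V × V → ℝ} {x : V × V → List E → ℝ} (hx : x ∈ M.routeFlows s)
    {t : E → ℝ} (ht : t ∈ M.weights) : M.innerObj s t ≤ M.Ψ x := by
  rw [innerObj_eq]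
  have h1 := M.sum_T_le hx t
  have h2 : ∑ e, M.edgeFlow x e * t e - M.Ψ x ≤ ∑ e, M.σConj e (t e) := by
    rw [Ψ, ← Finset.sum_sub_distrib]
    exact Finset.sum_le_sum fun e _ => M.le_σConj e (M.edgeFlow_nonneg hx e) (ht e).2
  linarith

theorem innerObj_le_Φ {s : V × V → ℝ} (hs : ∀ w ∈ M.OD, 0 ≤ s w) {t : E → ℝ}
    (ht : t ∈ M.weights) : M.innerObj s t ≤ M.Φ s := by
  obtain ⟨x, hx, hmin⟩ := M.exists_isMinOn_Ψ hs
  rw [M.Φ_eq_of_isMinOn hx hmin]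
  exact M.innerObj_le_Ψ hx ht

theorem innerObj_combo (s s' : V × V → ℝ) (t : E → ℝ) {a b : ℝ} (hab : a + b = 1) :
    M.innerObj (a • s + b • s') t = a * M.innerObj s t + b * M.innerObj s' t := by
  have h : ∑ w ∈ M.OD, (a • s + b • s') w * M.T w t
      = a * ∑ w ∈ M.OD, s w * M.T w t + b * ∑ w ∈ M.OD, s' w * M.T w t := by
    simp only [Finset.mul_sum, ← Finset.sum_add_distrib]
    refine Finset.sum_congr rfl fun w _ => ?_
    simp only [Pi.add_apply, Pi.smul_apply, smul_eq_mul]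
    ring
  simp only [innerObj_eq, h]
  obtain rfl : b = 1 - a := by linarith
  ring

/-- For given demands there are edge weights at which the inner maximum is attained, and for which
`innerObj` is not only a supporting affine function of the potential but also exact to first order
along every segment. -/
theorem exists_tangent_weights {s : V × V → ℝ} (hs : ∀ w ∈ M.OD, 0 ≤ s w) :
    ∃ t ∈ M.weights, M.innerObj s t = M.Φ s ∧ ∀ s' : V × V → ℝ, (∀ w ∈ M.OD, 0 ≤ s' w) →
      ∃ ρ : ℝ → ℝ, Tendsto ρ (𝓝[Set.Ioc 0 1] 0) (𝓝 0) ∧ ∀ ε ∈ Set.Ioc (0 : ℝ) 1,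
        M.Φ ((1 - ε) • s + ε • s') ≤ M.innerObj ((1 - ε) • s + ε • s') t + ε * ρ ε := by
  obtain ⟨x, hx, hmin⟩ := M.exists_isMinOn_Ψ hs
  set t : E → ℝ := fun e => M.τ e (M.edgeFlow x e) with ht
  -- No duality gap at the edge costs of the minimizer: `sum_T_eq` and Fenchel's equality are both
  -- tight there.
  have hobj : M.innerObj s t = M.Ψ x := by
    rw [innerObj_eq, M.sum_T_eq hs hx hmin, ← Finset.sum_sub_distrib]
    refine Finset.sum_congr rfl fun e _ => ?_
    rw [ht, M.σConj_τ e (M.edgeFlow_nonneg hx e)]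
    ring
  refine ⟨t, fun e => ⟨M.tbar_le_τ e (M.edgeFlow_nonneg hx e),
    M.τ_mem_conjDomain e (M.edgeFlow_nonneg hx e)⟩, ?_, fun s' hs' => ?_⟩
  · rw [hobj, M.Φ_eq_of_isMinOn hx hmin]
  -- Since `x'` uses shortest routes for `t`, the slope of `innerObj · t` from `s` to `s'` is the
  -- derivative of `Ψ` at `x` towards `x'`. The error `ρ` measures only the variation of the edge
  -- costs along the segment.
  · obtain ⟨x', hx', hsx'⟩ := M.exists_shortest_flow hs' t
    refine ⟨fun ε => ∑ e, (M.edgeFlow x' e - M.edgeFlow x e) *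
      (M.τ e (M.edgeFlow ((1 - ε) • x + ε • x') e) - t e), ?_, fun ε hε => ?_⟩
    · have hlim := tendsto_finsetSum Finset.univ fun e _ =>
        ((M.tendsto_τ_combo hx hx' e).sub_const (t e)).const_mul (M.edgeFlow x' e - M.edgeFlow x e)
      simpa [ht] using hlim
    · have hmem := M.routeFlows_combo hx hx' (sub_nonneg.2 hε.2) hε.1.le
      have hpos : ∀ w ∈ M.OD, 0 ≤ ((1 - ε) • s + ε • s') w := fun w hw =>
        add_nonneg (mul_nonneg (sub_nonneg.2 hε.2) (hs w hw)) (mul_nonneg hε.1.le (hs' w hw))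
      have h1 := (M.Φ_le hpos hmem).trans (M.Ψ_combo_le hx hx' hε)
      rw [M.innerObj_combo s s' t (sub_add_cancel 1 ε)]
      have h2 : M.innerObj s' t - M.innerObj s t = ∑ e, (M.edgeFlow x' e - M.edgeFlow x e) * t e := by
        simp only [sub_mul, Finset.sum_sub_distrib]
        rw [innerObj_eq, innerObj_eq, hsx', M.sum_T_eq hs hx hmin]
        ring
      simp only [mul_sub, Finset.sum_sub_distrib]
      rw [← h2, hobj]
      linarith

theorem exists_innerObj_eq {s : V × V → ℝ} (hs : ∀ w ∈ M.OD, 0 ≤ s w) :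
    ∃ t ∈ M.weights, M.innerObj s t = M.Φ s := by
  obtain ⟨t, ht, h, -⟩ := M.exists_tangent_weights hs
  exact ⟨t, ht, h⟩

theorem innerMax_eq {s : V × V → ℝ} (hs : ∀ w ∈ M.OD, 0 ≤ s w) : M.innerMax s = M.Φ s := by
  obtain ⟨t, ht, h⟩ := M.exists_innerObj_eq hs
  exact IsGreatest.csSup_eq ⟨⟨t, ht, h⟩, by rintro _ ⟨u, hu, rfl⟩; exact M.innerObj_le_Φ hs hu⟩

theorem convexOn_Φ : ConvexOn ℝ {s : V × V → ℝ | ∀ w ∈ M.OD, 0 ≤ s w} M.Φ := by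
  have hc : Convex ℝ {s : V × V → ℝ | ∀ w ∈ M.OD, 0 ≤ s w} :=
    fun s hs s' hs' a b ha hb _ w hw =>
      add_nonneg (mul_nonneg ha (hs w hw)) (mul_nonneg hb (hs' w hw))
  refine ⟨hc, fun s hs s' hs' a b ha hb hab => ?_⟩
  obtain ⟨t, ht, h⟩ := M.exists_innerObj_eq (hc hs hs' ha hb hab)
  rw [← h, M.innerObj_combo s s' t hab]
  exact add_le_add (mul_le_mul_of_nonneg_left (M.innerObj_le_Φ hs ht) ha)
    (mul_le_mul_of_nonneg_left (M.innerObj_le_Φ hs' ht) hb)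

/-- On nonnegative demands `Φ` is an attained maximum of the functions `innerObj · t`, which are
continuous in the demands. -/
theorem lowerSemicontinuousOn_Φ :
    LowerSemicontinuousOn M.Φ {s : V × V → ℝ | ∀ w ∈ M.OD, 0 ≤ s w} := by
  intro s hs y hy
  obtain ⟨t, ht, h⟩ := M.exists_innerObj_eq hs
  rw [← h] at hy
  have hc : Continuous fun s => M.innerObj s t := by
    simp only [innerObj_eq]
    fun_prop
  filter_upwards [nhdsWithin_le_nhds (hc.continuousAt.eventually (lt_mem_nhds hy)),
    self_mem_nhdsWithin] with s' h1 h2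
  exact h1.trans_le (M.innerObj_le_Φ h2 ht)

/-- Weights optimal for the smaller demands are tested at the larger ones; a removed unit saves at
least `-∑ e, |tbar e|`. -/
theorem Φ_le_add {s s' : V × V → ℝ} (hs : ∀ w ∈ M.OD, 0 ≤ s w) (hs' : ∀ w ∈ M.OD, 0 ≤ s' w)
    (h : ∀ w ∈ M.OD, s' w ≤ s w) :
    M.Φ s' ≤ M.Φ s + ∑ w ∈ M.OD, (∑ e, |M.tbar e|) * (s w - s' w) := by
  obtain ⟨t, ht, h'⟩ := M.exists_innerObj_eq hs'
  have h1 := M.innerObj_le_Φ hs ht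
  have h2 : ∑ w ∈ M.OD, s' w * M.T w t ≤
      ∑ w ∈ M.OD, s w * M.T w t + ∑ w ∈ M.OD, (∑ e, |M.tbar e|) * (s w - s' w) := by
    rw [← Finset.sum_add_distrib]
    refine Finset.sum_le_sum fun w hw => ?_
    nlinarith [mul_le_mul_of_nonneg_left (M.T_ge_of_weights hw ht) (sub_nonneg.2 (h w hw))]
  rw [innerObj_eq] at h' h1
  linarith

/-! ### Decomposition of the saddle function -/

/-- The demand for goods at a destination: final consumption and, at origins, consumption by the
producer. -/
def need (L W : V → Fin m → ℝ) (j : V) : Fin m → ℝ :=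
  W j + if j ∈ M.O then M.A j *ᵥ L j else 0

/-- The excess of shipments over production at the origin `i`. -/
def originExcess (z : Plan V m) (i : V) : Fin m → ℝ := M.outflow z.1 i - z.2.1.2 i

/-- The excess of needs over arrivals at the destination `j`. -/
def destExcess (z : Plan V m) (j : V) : Fin m → ℝ := M.need z.2.1.2 z.2.2.2 j - M.inflow z.1 j

/-- The excess of the consumption of raw materials over the available amounts. -/
def materialExcess (z : Plan V m) : Fin q → ℝ := ∑ i ∈ M.O, M.R i *ᵥ z.2.1.2 i - M.b

/-- The value of all excesses at the prices `π`. -/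
def pairing (π : Prices V m q) (z : Plan V m) : ℝ :=
  ∑ i ∈ M.O, π.1 i ⬝ᵥ M.originExcess z i + ∑ j ∈ M.D, π.2.1 j ⬝ᵥ M.destExcess z j
    + π.2.2 ⬝ᵥ M.materialExcess z

/-- The entropy term of the carrier. -/
noncomputable def entropy (d : V × V → Fin m → ℝ) : ℝ := M.γ * ∑ w ∈ M.OD, total d w * Real.log (total d w)

/-- The social cost of a plan without the transport potential. -/
noncomputable def baseCost (z : Plan V m) : ℝ :=
  ∑ i ∈ M.O, (z.2.1.1 i * M.χ i + M.c i ⬝ᵥ z.2.1.2 i) - ∑ j ∈ M.D, z.2.2.1 j * M.inc j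
    + M.entropy z.1

/-- The social cost of a plan. -/
noncomputable def cost (z : Plan V m) : ℝ := M.baseCost z + M.Φ (total z.1)

theorem sum_O_eq_sum_D (f g : V → Fin m → ℝ) :
    ∑ i ∈ M.O, f i ⬝ᵥ g i = ∑ j ∈ M.D, f j ⬝ᵥ (if j ∈ M.O then g j else 0) := by
  rw [← Finset.sum_subset M.O_subset_D fun j _ hj => by simp [hj]]
  exact Finset.sum_congr rfl fun i hi => by simp [hi]

/-- Each price multiplies exactly one excess. A producer buys its inputs at the destination prices
of its own vertex, so these terms join the needs at destinations, using `O ⊆ D`. -/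
theorem saddleFun_eq (z : Plan V m) (ξ : Prices V m q × (E → ℝ)) :
    M.saddleFun z ξ = M.baseCost z + M.pairing ξ.1 z + M.innerObj (total z.1) ξ.2 := by
  have h := M.sum_O_eq_sum_D ξ.1.2.1 fun i => M.A i *ᵥ z.2.1.2 i
  simp only [saddleFun, baseCost, pairing, profit, originExcess, destExcess, materialExcess, need,
    tradeCost, entropy, dotProduct_sub, dotProduct_add, Finset.sum_sub_distrib,
    Finset.sum_add_distrib, dotProduct_sum, ← h]
  ring

/-! ### Affinity and convexity -/

section Affine

variable (z z' : Plan V m) {a b : ℝ}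

theorem total_combo (d d' : V × V → Fin m → ℝ) (a b : ℝ) :
    total (a • d + b • d') = a • total d + b • total d' := by
  funext w
  simp [total, Finset.sum_add_distrib, Finset.mul_sum]

theorem outflow_combo (d d' : V × V → Fin m → ℝ) (a b : ℝ) (i : V) :
    M.outflow (a • d + b • d') i = a • M.outflow d i + b • M.outflow d' i := by
  simp [outflow, Finset.sum_add_distrib, Finset.smul_sum]

theorem inflow_combo (d d' : V × V → Fin m → ℝ) (a b : ℝ) (i : V) :
    M.inflow (a • d + b • d') i = a • M.inflow d i + b • M.inflow d' i := by
  simp [inflow, Finset.sum_add_distrib, Finset.smul_sum]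

theorem need_combo (L W L' W' : V → Fin m → ℝ) (a b : ℝ) (j : V) :
    M.need (a • L + b • L') (a • W + b • W') j = a • M.need L W j + b • M.need L' W' j := by
  unfold need
  split_ifs
  · simp only [Pi.add_apply, Pi.smul_apply, Matrix.mulVec_add, Matrix.mulVec_smul, smul_add]
    abel
  · simp

theorem originExcess_combo (i : V) : M.originExcess (a • z + b • z') i =
    a • M.originExcess z i + b • M.originExcess z' i := by
  simp only [originExcess, Prod.fst_add, Prod.snd_add, Prod.smul_fst, Prod.smul_snd, outflow_combo,
    Pi.add_apply, Pi.smul_apply, smul_sub]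
  abel

theorem destExcess_combo (j : V) : M.destExcess (a • z + b • z') j =
    a • M.destExcess z j + b • M.destExcess z' j := by
  simp only [destExcess, Prod.fst_add, Prod.snd_add, Prod.smul_fst, Prod.smul_snd, inflow_combo,
    need_combo, smul_sub]
  abel

theorem materialExcess_combo (hab : a + b = 1) : M.materialExcess (a • z + b • z') =
    a • M.materialExcess z + b • M.materialExcess z' := by
  have hb : M.b = a • M.b + b • M.b := by rw [← add_smul, hab, one_smul]
  simp only [materialExcess, Prod.snd_add, Prod.fst_add, Prod.smul_fst, Prod.smul_snd,
    Pi.add_apply, Pi.smul_apply, Matrix.mulVec_add, Matrix.mulVec_smul, Finset.sum_add_distrib,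
    ← Finset.smul_sum, smul_sub]
  nth_rw 1 [hb]
  abel

theorem pairing_combo (π : Prices V m q) (hab : a + b = 1) :
    M.pairing π (a • z + b • z') = a * M.pairing π z + b * M.pairing π z' := by
  simp only [pairing, originExcess_combo, destExcess_combo, M.materialExcess_combo z z' hab,
    dotProduct_add, dotProduct_smul, smul_eq_mul, Finset.sum_add_distrib, ← Finset.mul_sum]
  ring

theorem pairing_combo_left (π π' : Prices V m q) (a b : ℝ) :
    M.pairing (a • π + b • π') z = a * M.pairing π z + b * M.pairing π' z := by
  simp only [pairing, Prod.fst_add, Prod.snd_add, Prod.smul_fst, Prod.smul_snd,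
    Pi.add_apply, Pi.smul_apply, add_dotProduct, smul_dotProduct, smul_eq_mul,
    Finset.sum_add_distrib, ← Finset.mul_sum]
  ring

end Affine

theorem total_nonneg {d : V × V → Fin m → ℝ} (hd : d ∈ M.shipments) :
    ∀ w ∈ M.OD, 0 ≤ total d w := fun w hw => Finset.sum_nonneg fun k _ => hd w hw k

theorem convex_shipments : Convex ℝ M.shipments := fun _ hd _ hd' _ _ ha hb _ w hw =>
  add_nonneg (smul_nonneg ha (hd w hw)) (smul_nonneg hb (hd' w hw))

theorem convex_consumptionSet (j : V) : Convex ℝ (M.consumptionSet j) := by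
  intro W hW W' hW' a b ha hb hab
  refine ⟨add_nonneg (smul_nonneg ha hW.1) (smul_nonneg hb hW'.1), ?_⟩
  have h : M.req j = a • M.req j + b • M.req j := by rw [← add_smul, hab, one_smul]
  rw [h, Matrix.mulVec_add, Matrix.mulVec_smul, Matrix.mulVec_smul]
  exact add_le_add (smul_le_smul_of_nonneg_left hW.2 ha) (smul_le_smul_of_nonneg_left hW'.2 hb)

theorem mem_smul_combo {S : Set (Fin m → ℝ)} (hS : Convex ℝ S) {α α' : ℝ} {L L' : Fin m → ℝ}
    (hα : 0 ≤ α) (hα' : 0 ≤ α') (hL : L ∈ α • S) (hL' : L' ∈ α' • S) {a b : ℝ} (ha : 0 ≤ a)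
    (hb : 0 ≤ b) : a • L + b • L' ∈ (a * α + b * α') • S := by
  rw [hS.add_smul (mul_nonneg ha hα) (mul_nonneg hb hα'), mul_smul, mul_smul]
  exact Set.add_mem_add (Set.smul_mem_smul_set hL) (Set.smul_mem_smul_set hL')

theorem convex_planSet : Convex ℝ M.planSet := by
  intro z hz z' hz' a b ha hb hab
  refine ⟨M.convex_shipments hz.1 hz'.1 ha hb hab, fun i hi => ?_, fun j hj => ?_⟩
  · have h := hz.2.1 i hi
    have h' := hz'.2.1 i hi
    exact ⟨convex_Icc 0 1 h.1 h'.1 ha hb hab,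
      mem_smul_combo (M.U_convex i hi) h.1.1 h'.1.1 h.2 h'.2 ha hb⟩
  · have h := hz.2.2 j hj
    have h' := hz'.2.2 j hj
    exact ⟨convex_Icc 0 1 h.1 h'.1 ha hb hab,
      mem_smul_combo (M.convex_consumptionSet j) h.1.1 h'.1.1 h.2 h'.2 ha hb⟩

theorem convexOn_entropy : ConvexOn ℝ M.shipments M.entropy := by
  refine ⟨M.convex_shipments, fun d hd d' hd' a b ha hb hab => ?_⟩
  simp only [entropy, total_combo, smul_eq_mul]
  rw [mul_left_comm a, mul_left_comm b, ← mul_add, Finset.mul_sum (a := a), Finset.mul_sum (a := b),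
    ← Finset.sum_add_distrib]
  refine mul_le_mul_of_nonneg_left (Finset.sum_le_sum fun w hw => ?_) M.γ_nonneg
  exact Real.convexOn_mul_log.2 (M.total_nonneg hd w hw) (M.total_nonneg hd' w hw) ha hb hab

theorem convexOn_baseCost : ConvexOn ℝ M.planSet M.baseCost := by
  refine ⟨M.convex_planSet, fun z hz z' hz' a b ha hb hab => ?_⟩
  have h := M.convexOn_entropy.2 hz.1 hz'.1 ha hb hab
  simp only [baseCost, Prod.fst_add, Prod.snd_add, Prod.smul_fst, Prod.smul_snd, Pi.add_apply,
    Pi.smul_apply, dotProduct_add, dotProduct_smul, smul_eq_mul, add_mul, mul_assoc,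
    Finset.sum_add_distrib, ← Finset.mul_sum] at h ⊢
  linarith

theorem convexOn_cost : ConvexOn ℝ M.planSet M.cost := by
  refine M.convexOn_baseCost.add ⟨M.convex_planSet, fun z hz z' hz' a b ha hb hab => ?_⟩
  simp only [Prod.fst_add, Prod.smul_fst, total_combo]
  exact M.convexOn_Φ.2 (M.total_nonneg hz.1) (M.total_nonneg hz'.1) ha hb hab

theorem convexOn_saddleFun (ξ : Prices V m q × (E → ℝ)) :
    ConvexOn ℝ M.planSet fun z => M.saddleFun z ξ := by
  refine ⟨M.convex_planSet, fun z hz z' hz' a b ha hb hab => ?_⟩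
  have h := M.convexOn_baseCost.2 hz hz' ha hb hab
  simp only [saddleFun_eq, M.pairing_combo z z' ξ.1 hab, smul_eq_mul] at h ⊢
  rw [Prod.fst_add, Prod.smul_fst, Prod.smul_fst, total_combo,
    M.innerObj_combo _ _ _ hab]
  linarith

theorem convex_priceSet : Convex ℝ M.priceSet := fun _ hπ _ hπ' _ _ ha hb _ =>
  ⟨fun i hi => add_nonneg (smul_nonneg ha (hπ.1 i hi)) (smul_nonneg hb (hπ'.1 i hi)),
    fun i hi => add_nonneg (smul_nonneg ha (hπ.2.1 i hi)) (smul_nonneg hb (hπ'.2.1 i hi)),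
    add_nonneg (smul_nonneg ha hπ.2.2) (smul_nonneg hb hπ'.2.2)⟩

theorem concaveOn_innerObj {s : V × V → ℝ} (hs : ∀ w ∈ M.OD, 0 ≤ s w) :
    ConcaveOn ℝ M.weights (M.innerObj s) := by
  refine ⟨M.convex_weights, fun t ht u hu a b ha hb hab => ?_⟩
  simp only [innerObj_eq, smul_eq_mul, mul_sub, Finset.mul_sum]
  have h1 : ∑ w ∈ M.OD, a * (s w * M.T w t) + ∑ w ∈ M.OD, b * (s w * M.T w u) ≤
      ∑ w ∈ M.OD, s w * M.T w (a • t + b • u) := by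
    rw [← Finset.sum_add_distrib]
    refine Finset.sum_le_sum fun w hw => ?_
    have := mul_le_mul_of_nonneg_left (M.T_combo_ge hw t u ha hb) (hs w hw)
    linarith
  have h2 : ∑ e, M.σConj e ((a • t + b • u) e) ≤
      ∑ e, a * M.σConj e (t e) + ∑ e, b * M.σConj e (u e) := by
    rw [← Finset.sum_add_distrib]
    exact Finset.sum_le_sum fun e _ => (M.convexOn_σConj e).2 (ht e).2 (hu e).2 ha hb hab
  linarith

theorem concaveOn_saddleFun {z : Plan V m} (hz : z ∈ M.planSet) :
    ConcaveOn ℝ M.dualSet fun ξ => M.saddleFun z ξ := by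
  refine ⟨M.convex_priceSet.prod M.convex_weights, fun ξ hξ ξ' hξ' a b ha hb hab => ?_⟩
  have h := (M.concaveOn_innerObj (M.total_nonneg hz.1)).2 hξ.2 hξ'.2 ha hb hab
  simp only [saddleFun_eq, smul_eq_mul, Prod.fst_add, Prod.snd_add, Prod.smul_fst, Prod.smul_snd,
    M.pairing_combo_left z] at h ⊢
  obtain rfl : b = 1 - a := by linarith
  linarith

/-! ### Balance inequalities -/

/-- The plan satisfies all balance inequalities. -/
def IsBalanced (z : Plan V m) : Prop :=
  (∀ i ∈ M.O, M.originExcess z i ≤ 0) ∧ (∀ j ∈ M.D, M.destExcess z j ≤ 0) ∧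
    M.materialExcess z ≤ 0

theorem dotProduct_nonpos {n : ℕ} {p v : Fin n → ℝ} (hp : 0 ≤ p) (hv : v ≤ 0) : p ⬝ᵥ v ≤ 0 :=
  Finset.sum_nonpos fun k _ => mul_nonpos_of_nonneg_of_nonpos (hp k) (hv k)

variable {M}

theorem IsBalanced.pairing_nonpos {z : Plan V m} (hz : M.IsBalanced z) {π : Prices V m q}
    (hπ : π ∈ M.priceSet) : M.pairing π z ≤ 0 :=
  add_nonpos (add_nonpos
    (Finset.sum_nonpos fun i hi => dotProduct_nonpos (hπ.1 i hi) (hz.1 i hi))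
    (Finset.sum_nonpos fun j hj => dotProduct_nonpos (hπ.2.1 j hj) (hz.2.1 j hj)))
    (dotProduct_nonpos hπ.2.2 hz.2.2)

variable (M)

theorem isBalanced_of_pairing_nonpos {z : Plan V m}
    (h : ∀ π ∈ M.priceSet, M.pairing π z ≤ 0) : M.IsBalanced z := by
  refine ⟨fun i hi k => ?_, fun j hj k => ?_, fun k => ?_⟩
  · have := h (Pi.single i (Pi.single k 1), 0, 0) ⟨fun i' _ => ?_, fun _ _ => le_rfl, le_rfl⟩
    · rw [pairing, Finset.sum_eq_single_of_mem i hi fun i' _ hne => by simp [hne]] at this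
      simpa using this
    · by_cases hii : i' = i
      · subst hii; simp
      · simp [hii]
  · have := h (0, Pi.single j (Pi.single k 1), 0) ⟨fun _ _ => le_rfl, fun j' _ => ?_, le_rfl⟩
    · rw [pairing, Finset.sum_eq_single_of_mem (s := M.D) j hj fun j' _ hne => by simp [hne]] at this
      simpa using this
    · by_cases hii : j' = j
      · subst hii; simp
      · simp [hii]
  · have := h (0, 0, Pi.single k 1) ⟨fun _ _ => le_rfl, fun _ _ => le_rfl, by simp⟩
    simpa [pairing] using this

theorem walrasLaws_of_pairing {z : Plan V m} {π : Prices V m q} (hπ : π ∈ M.priceSet)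
    (hz : M.IsBalanced z) (h : 0 ≤ M.pairing π z) :
    M.WalrasLaws z.1 z.2.1.2 z.2.2.2 π := by
  have hO : ∀ i ∈ M.O, π.1 i ⬝ᵥ M.originExcess z i ≤ 0 :=
    fun i hi => dotProduct_nonpos (hπ.1 i hi) (hz.1 i hi)
  have hD : ∀ j ∈ M.D, π.2.1 j ⬝ᵥ M.destExcess z j ≤ 0 :=
    fun j hj => dotProduct_nonpos (hπ.2.1 j hj) (hz.2.1 j hj)
  have hm := dotProduct_nonpos hπ.2.2 hz.2.2
  have sO := Finset.sum_nonpos hO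
  have sD := Finset.sum_nonpos hD
  unfold pairing at h
  have eO := (Finset.sum_eq_zero_iff_of_nonpos hO).1 (by linarith)
  have eD := (Finset.sum_eq_zero_iff_of_nonpos hD).1 (by linarith)
  have em : π.2.2 ⬝ᵥ M.materialExcess z = 0 := by linarith
  have nO : ∀ j ∈ M.O, M.destExcess z j = z.2.2.2 j + M.A j *ᵥ z.2.1.2 j - M.inflow z.1 j :=
    fun j hj => by simp [destExcess, need, hj]
  have nD : ∀ j ∈ M.D \ M.O, M.destExcess z j = z.2.2.2 j - M.inflow z.1 j :=
    fun j hj => by simp [destExcess, need, (Finset.mem_sdiff.1 hj).2]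
  refine ⟨hπ, fun i hi => sub_nonpos.1 (hz.1 i hi), eO, fun i hi => ?_, fun i hi => ?_,
    fun j hj => ?_, fun j hj => ?_, sub_nonpos.1 hz.2.2, ?_⟩
  · exact sub_nonpos.1 (nO i hi ▸ hz.2.1 i (M.O_subset_D hi))
  · exact nO i hi ▸ eD i (M.O_subset_D hi)
  · exact sub_nonpos.1 (nD j hj ▸ hz.2.1 j (Finset.mem_sdiff.1 hj).1)
  · exact nD j hj ▸ eD j (Finset.mem_sdiff.1 hj).1
  · rw [← neg_sub, dotProduct_neg]
    exact neg_eq_zero.2 em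

/-! ### Saddle points are equilibria -/

/-- A linear function bounded above on a cone is nonpositive there and has maximum zero, which gives
balance and complementary slackness. For fixed prices the saddle function is a sum over agents, so
unilateral changes of `z` test each agent separately. -/
theorem isCompetitiveEquilibrium_of_isSaddlePointOn {z : Plan V m} (hz : z ∈ M.planSet)
    {ξ : Prices V m q × (E → ℝ)} (hξ : ξ ∈ M.dualSet)
    (h : IsSaddlePointOn M.planSet M.dualSet M.saddleFun z ξ) :
    M.IsCompetitiveEquilibrium z.1 z.2.1.2 z.2.2.2 ξ.1 := by
  have hprice : ∀ π ∈ M.priceSet, M.pairing π z ≤ M.pairing ξ.1 z := fun π hπ => by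
    have := h z hz (π, ξ.2) ⟨hπ, hξ.2⟩
    simp only [saddleFun_eq] at this
    linarith
  have hpos : 0 ≤ M.pairing ξ.1 z := by
    have := hprice 0 ⟨fun _ _ => le_rfl, fun _ _ => le_rfl, le_rfl⟩
    simpa [pairing] using this
  -- Adding any `π` to the maximizing prices cannot increase the pairing.
  have hbal : M.IsBalanced z := M.isBalanced_of_pairing_nonpos fun π hπ => by
    have := hprice (π + ξ.1)
      ⟨fun i hi => add_nonneg (hπ.1 i hi) (hξ.1.1 i hi),
        fun i hi => add_nonneg (hπ.2.1 i hi) (hξ.1.2.1 i hi), add_nonneg hπ.2.2 hξ.1.2.2⟩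
    have h2 := M.pairing_combo_left z π ξ.1 1 1
    simp only [one_smul, one_mul] at h2
    linarith
  have hmin : ∀ z' ∈ M.planSet, M.saddleFun z ξ ≤ M.saddleFun z' ξ := fun z' hz' => h z' hz' ξ hξ
  refine ⟨fun i hi => ⟨z.2.1.1 i, (hz.2.1 i hi).1, (hz.2.1 i hi).2, fun α' hα' L' hL' => ?_⟩,
    fun j hj => ⟨z.2.2.1 j, (hz.2.2 j hj).1, (hz.2.2 j hj).2, fun β' hβ' W' hW' => ?_⟩,
    ⟨hz.1, fun d' hd' => ?_⟩, M.walrasLaws_of_pairing hξ.1 hbal hpos⟩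
  · have := hmin (z.1, (Function.update z.2.1.1 i α', Function.update z.2.1.2 i L'), z.2.2)
      ⟨hz.1, fun i' hi' => ?_, hz.2.2⟩
    · simp only [saddleFun] at this
      rw [← Finset.add_sum_erase _ _ hi, ← Finset.add_sum_erase (a := i) _ (fun i' =>
        M.profit ξ.1.1 ξ.1.2.1 ξ.1.2.2 i' (Function.update z.2.1.1 i α' i')
          (Function.update z.2.1.2 i L' i')) hi] at this
      rw [Finset.sum_congr (s₁ := M.O.erase i) (g := fun i' =>
        M.profit ξ.1.1 ξ.1.2.1 ξ.1.2.2 i' (z.2.1.1 i') (z.2.1.2 i')) (f := fun i' =>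
        M.profit ξ.1.1 ξ.1.2.1 ξ.1.2.2 i' (Function.update z.2.1.1 i α' i')
          (Function.update z.2.1.2 i L' i')) rfl fun i' hi' => by
          simp [Finset.ne_of_mem_erase hi']] at this
      simp only [Function.update_self] at this
      linarith
    · rcases eq_or_ne i' i with rfl | hne
      · simpa using ⟨hα', hL'⟩
      · simpa [hne] using hz.2.1 i' hi'
  · have := hmin (z.1, z.2.1, (Function.update z.2.2.1 j β', Function.update z.2.2.2 j W'))
      ⟨hz.1, hz.2.1, fun j' hj' => ?_⟩
    · simp only [saddleFun] at this
      rw [← Finset.add_sum_erase (a := j) M.D (fun j => z.2.2.1 j * M.inc j - _) hj,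
        ← Finset.add_sum_erase (a := j) _ (fun j' => Function.update z.2.2.1 j β' j' * M.inc j' -
          ξ.1.2.1 j' ⬝ᵥ Function.update z.2.2.2 j W' j') hj] at this
      rw [Finset.sum_congr (s₁ := M.D.erase j) (g := fun j' => z.2.2.1 j' * M.inc j' -
        ξ.1.2.1 j' ⬝ᵥ z.2.2.2 j') (f := fun j' => Function.update z.2.2.1 j β' j' * M.inc j' -
          ξ.1.2.1 j' ⬝ᵥ Function.update z.2.2.2 j W' j') rfl fun j' hj' => by
          simp [Finset.ne_of_mem_erase hj']] at this
      simp only [Function.update_self] at this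
      linarith
    · rcases eq_or_ne j' j with rfl | hne
      · simpa using ⟨hβ', hW'⟩
      · simpa [hne] using hz.2.2 j' hj'
  -- The two sides use different weights: those optimal for the current demands produce `Φ` on the
  -- left, while on the right the saddle weights are bounded above by `Φ`.
  · obtain ⟨t, ht, heq⟩ := M.exists_innerObj_eq (M.total_nonneg hz.1)
    have h1 := h (d', z.2) ⟨hd', hz.2⟩ (ξ.1, t) ⟨hξ.1, ht⟩
    have h2 := M.innerObj_le_Φ (M.total_nonneg hd') hξ.2
    simp only [saddleFun, heq] at h1
    linarith

/-! ### Lagrange multipliers -/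

/-- Lagrange multipliers exist for a convex program with finitely many convex inequality constraints
satisfying Slater's condition. -/
theorem exists_lagrange_multipliers {X ι : Type*} [AddCommGroup X] [Module ℝ X] [Fintype ι]
    {Z : Set X} {f : X → ℝ} {G : ι → X → ℝ} (hf : ConvexOn ℝ Z f) (hG : ∀ i, ConvexOn ℝ Z (G i))
    {c : ℝ} (hc : ∀ z ∈ Z, (∀ i, G i z ≤ 0) → c ≤ f z) {z₀ : X} (hz₀ : z₀ ∈ Z)
    (h₀ : ∀ i, G i z₀ < 0) :
    ∃ p : ι → ℝ, 0 ≤ p ∧ ∀ z ∈ Z, c ≤ f z + ∑ i, p i * G i z := by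
  classical
  -- Strict inequalities make this set of attainable bounds open without any continuity of `f` or
  -- `G`, so it can be separated from `(0, c)`.
  set S : Set ((ι → ℝ) × ℝ) := {a | ∃ z ∈ Z, (∀ i, G i z < a.1 i) ∧ f z < a.2} with hS
  have hopen : IsOpen S := by
    have : S = ⋃ z ∈ Z, (⋂ i, {a | G i z < a.1 i}) ∩ {a | f z < a.2} := by
      ext a
      simp [hS, and_left_comm]
    rw [this]
    refine isOpen_biUnion fun z _ => (isOpen_iInter_of_finite fun i => ?_).inter ?_
    · exact isOpen_lt continuous_const (by fun_prop)
    · exact isOpen_lt continuous_const continuous_snd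
  have hconv : Convex ℝ S := by
    rintro a ⟨z, hz, hza, hza'⟩ a' ⟨z', hz', hza1, hza2⟩ u v hu hv huv
    have hlt : ∀ {x y x' y' : ℝ}, x < y → x' < y' → u * x + v * x' < u * y + v * y' := by
      intro x y x' y' h h'
      rcases hu.eq_or_lt with rfl | hu'
      · obtain rfl : v = 1 := by linarith
        linarith
      · nlinarith [mul_le_mul_of_nonneg_left h'.le hv, mul_lt_mul_of_pos_left h hu']
    exact ⟨u • z + v • z', hf.1 hz hz' hu hv huv,
      fun i => ((hG i).2 hz hz' hu hv huv).trans_lt (hlt (hza i) (hza1 i)),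
      (hf.2 hz hz' hu hv huv).trans_lt (hlt hza' hza2)⟩
  have hnot : ((0, c) : (ι → ℝ) × ℝ) ∉ S := by
    rintro ⟨z, hz, hz1, hz2⟩
    exact (hc z hz fun i => (hz1 i).le).not_gt hz2
  obtain ⟨φ, hφ⟩ := geometric_hahn_banach_open_point hconv hopen hnot
  set p : ι → ℝ := fun i => -φ (Pi.single i 1, 0) with hp
  set κ : ℝ := -φ (0, 1) with hκ
  have hφ_eq : ∀ u ρ, -φ (u, ρ) = ∑ i, p i * u i + κ * ρ := by
    intro u ρ
    have h1 : ((u, ρ) : (ι → ℝ) × ℝ)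
        = ∑ i, u i • ((Pi.single i 1, 0) : (ι → ℝ) × ℝ) + ρ • ((0, 1) : (ι → ℝ) × ℝ) := by
      ext i
      · simp [Finset.sum_apply, Pi.single_apply, Prod.fst_sum]
      · simp [Prod.snd_sum]
    rw [h1, map_add, map_sum, map_smul]
    simp only [map_smul, smul_eq_mul, hp, hκ, neg_add_rev, ← Finset.sum_neg_distrib]
    rw [add_comm]
    congr 1
    · exact Finset.sum_congr rfl fun i _ => by ring
    · ring
  have hsep : ∀ z ∈ Z, ∀ u : ι → ℝ, ∀ ρ, (∀ i, G i z < u i) → f z < ρ →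
      κ * c < ∑ i, p i * u i + κ * ρ := by
    intro z hz u ρ hu hρ
    have h := hφ (u, ρ) ⟨z, hz, hu, hρ⟩
    have h1 := hφ_eq u ρ
    have h2 := hφ_eq 0 c
    simp only [Pi.zero_apply, mul_zero, Finset.sum_const_zero, zero_add] at h2
    linarith
  have hle : ∀ a b : ℝ, (∀ n : ℝ, 0 ≤ n → a < b + n * κ) → 0 ≤ κ := by
    intro a b h
    by_contra! hneg
    have hn : 0 ≤ max 0 ((b - a) / -κ) := le_max_left _ _
    have h1 := h _ hn
    have h2 : (b - a) ≤ max 0 ((b - a) / -κ) * -κ :=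
      (div_le_iff₀ (by linarith)).1 (le_max_right _ _)
    linarith
  have hκ0 : 0 ≤ κ := by
    refine hle (κ * c) (κ * (f z₀ + 1)) fun n hn => ?_
    have := hsep z₀ hz₀ 0 (f z₀ + 1 + n) h₀ (by linarith)
    simp only [Pi.zero_apply, mul_zero, Finset.sum_const_zero, zero_add] at this
    linarith
  -- Slater's condition excludes a vertical hyperplane: `u = 0` is a strict bound at `z₀`, and `κ =
  -- 0` would give `0 < 0`.
  have hκpos : 0 < κ := by
    refine hκ0.lt_of_ne fun h => ?_
    have := hsep z₀ hz₀ 0 (f z₀ + 1) h₀ (by linarith)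
    simp [← h] at this
  have hp0 : ∀ i, 0 ≤ p i := by
    intro i
    by_contra! hneg
    -- A bound may be relaxed arbitrarily in one coordinate; this size contradicts separation if `p
    -- i < 0`.
    set n : ℝ := max 0 (κ * (f z₀ + 1 - c) / -p i) with hn
    have h1 := hsep z₀ hz₀ (Pi.single i n) (f z₀ + 1) (fun j => (h₀ j).trans_le ?_) (by linarith)
    · rw [Finset.sum_eq_single i (fun j _ hj => by simp [hj]) (by simp), Pi.single_eq_same] at h1
      have h2 : κ * (f z₀ + 1 - c) ≤ n * -p i :=
        (div_le_iff₀ (by linarith)).1 (le_max_right _ _)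
      linarith
    · exact (Pi.single_nonneg (i := i).2 (le_max_left 0 _) : (0 : ι → ℝ) ≤ Pi.single i n) j
  have hclosed : ∀ z ∈ Z, κ * c ≤ ∑ i, p i * G i z + κ * f z := by
    intro z hz
    have hlim : Tendsto (fun ε : ℝ => ∑ i, p i * (G i z + ε) + κ * (f z + ε)) (𝓝[>] 0)
        (𝓝 (∑ i, p i * (G i z + 0) + κ * (f z + 0))) :=
      (Continuous.tendsto (by fun_prop) 0).mono_left nhdsWithin_le_nhds
    simp only [add_zero] at hlim
    refine ge_of_tendsto hlim (eventually_nhdsWithin_of_forall fun ε (hε : 0 < ε) => ?_)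
    exact (hsep z hz (fun i => G i z + ε) (f z + ε) (fun i => by linarith) (by linarith)).le
  refine ⟨fun i => p i / κ, fun i => div_nonneg (hp0 i) hκ0, fun z hz => ?_⟩
  have h := hclosed z hz
  have h1 : ∑ i, p i / κ * G i z = (∑ i, p i * G i z) / κ := by
    rw [Finset.sum_div]
    exact Finset.sum_congr rfl fun i _ => by ring
  have h2 : c ≤ (∑ i, p i * G i z + κ * f z) / κ := by
    rw [le_div_iff₀ hκpos]
    linarith
  rw [h1]
  calc c ≤ _ := h2
    _ = _ := by field_simp; ring

/-! ### An optimal plan -/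

theorem Φ_congr {s s' : V × V → ℝ} (h : ∀ w ∈ M.OD, s w = s' w) : M.Φ s = M.Φ s' := by
  have : M.routeFlows s = M.routeFlows s' := by
    ext x
    refine forall₂_congr fun w hw => ?_
    rw [h w hw]
  rw [Φ, Φ, this]

/-- A plan with all irrelevant components replaced by zero. -/
def truncate (z : Plan V m) : Plan V m :=
  (fun w => if w ∈ M.OD then z.1 w else 0,
    (fun i => if i ∈ M.O then z.2.1.1 i else 0, fun i => if i ∈ M.O then z.2.1.2 i else 0),
    (fun j => if j ∈ M.D then z.2.2.1 j else 0, fun j => if j ∈ M.D then z.2.2.2 j else 0))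

theorem cost_truncate (z : Plan V m) : M.cost (M.truncate z) = M.cost z := by
  have ht : ∀ w ∈ M.OD, total (M.truncate z).1 w = total z.1 w := fun w hw => by
    simp [truncate, total, hw]
  have h1 : M.entropy (M.truncate z).1 = M.entropy z.1 := by
    rw [entropy, entropy, Finset.sum_congr rfl fun w hw => by rw [ht w hw]]
  have h2 : ∑ i ∈ M.O, ((M.truncate z).2.1.1 i * M.χ i + M.c i ⬝ᵥ (M.truncate z).2.1.2 i) =
      ∑ i ∈ M.O, (z.2.1.1 i * M.χ i + M.c i ⬝ᵥ z.2.1.2 i) :=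
    Finset.sum_congr rfl fun i hi => by simp [truncate, hi]
  have h3 : ∑ j ∈ M.D, (M.truncate z).2.2.1 j * M.inc j = ∑ j ∈ M.D, z.2.2.1 j * M.inc j :=
    Finset.sum_congr rfl fun j hj => by simp [truncate, hj]
  rw [cost, cost, M.Φ_congr ht, baseCost, baseCost, h1, h2, h3]

theorem outflow_congr {d d' : V × V → Fin m → ℝ} (h : ∀ w ∈ M.OD, d w = d' w) (i : V) :
    M.outflow d i = M.outflow d' i :=
  Finset.sum_congr rfl fun w hw => h w (Finset.mem_filter.1 hw).1

theorem inflow_congr {d d' : V × V → Fin m → ℝ} (h : ∀ w ∈ M.OD, d w = d' w) (i : V) :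
    M.inflow d i = M.inflow d' i :=
  Finset.sum_congr rfl fun w hw => h w (Finset.mem_filter.1 hw).1

theorem isBalanced_truncate {z : Plan V m} (hz : M.IsBalanced z) : M.IsBalanced (M.truncate z) := by
  have hd : ∀ w ∈ M.OD, (M.truncate z).1 w = z.1 w := fun w hw => by simp [truncate, hw]
  refine ⟨fun i hi => ?_, fun j hj => ?_, ?_⟩
  · have := hz.1 i hi
    rw [originExcess, M.outflow_congr hd]
    simpa [truncate, hi, originExcess] using this
  · have h := hz.2.1 j hj
    have : M.need (M.truncate z).2.1.2 (M.truncate z).2.2.2 j = M.need z.2.1.2 z.2.2.2 j := by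
      by_cases hO : j ∈ M.O <;> simp [need, truncate, hj, hO]
    rwa [destExcess, M.inflow_congr hd, this]
  · have h := hz.2.2
    rw [materialExcess] at h ⊢
    have : ∑ i ∈ M.O, M.R i *ᵥ (M.truncate z).2.1.2 i = ∑ i ∈ M.O, M.R i *ᵥ z.2.1.2 i :=
      Finset.sum_congr rfl fun i hi => by simp [truncate, hi]
    rwa [this]

theorem continuous_baseCost : Continuous (M.baseCost : Plan V m → ℝ) := by
  have h1 : Continuous fun z : Plan V m => M.entropy z.1 := by
    unfold entropy
    refine continuous_const.mul (continuous_finsetSum _ fun w _ =>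
      Real.continuous_mul_log.comp ?_)
    unfold total
    fun_prop
  have h2 : Continuous fun z : Plan V m =>
      ∑ i ∈ M.O, (z.2.1.1 i * M.χ i + M.c i ⬝ᵥ z.2.1.2 i) - ∑ j ∈ M.D, z.2.2.1 j * M.inc j := by
    unfold dotProduct
    fun_prop
  exact h2.add h1

theorem isClosed_isBalanced : IsClosed {z : Plan V m | M.IsBalanced z} := by
  have hO : ∀ i, Continuous fun z : Plan V m => M.originExcess z i := fun i => by
    unfold originExcess outflow
    fun_prop
  have hD : ∀ i, Continuous fun z : Plan V m => M.destExcess z i := fun j => by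
    unfold destExcess need inflow
    split_ifs <;> fun_prop
  have hm : Continuous fun z : Plan V m => M.materialExcess z := by
    unfold materialExcess
    fun_prop
  simp only [IsBalanced, Set.ofPred_and, Set.ofPred_forall]
  exact (isClosed_biInter fun i _ => isClosed_le (hO i) continuous_const).inter
    ((isClosed_biInter fun i _ => isClosed_le (hD i) continuous_const).inter
      (isClosed_le hm continuous_const))

theorem zero_smul_consumptionSet {j : V} (h : (M.consumptionSet j).Nonempty) {W : Fin m → ℝ} :
    W ∈ (0 : ℝ) • M.consumptionSet j ↔ W = 0 := by
  rw [Set.zero_smul_set h]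
  rfl

theorem mem_smul_consumptionSet {j : V} {β : ℝ} (hβ : 0 < β) {W : Fin m → ℝ} :
    W ∈ β • M.consumptionSet j ↔ 0 ≤ W ∧ β • M.req j ≤ M.Q j *ᵥ W := by
  rw [Set.mem_smul_set_iff_inv_smul_mem₀ hβ.ne']
  refine and_congr ?_ ?_
  · rw [le_inv_smul_iff_of_pos hβ, smul_zero]
  · rw [Matrix.mulVec_smul, le_inv_smul_iff_of_pos hβ]

theorem smul_consumptionSet_subset {j : V} {β : ℝ} (hβ : 0 ≤ β) {W : Fin m → ℝ}
    (hW : W ∈ β • M.consumptionSet j) : 0 ≤ W ∧ β • M.req j ≤ M.Q j *ᵥ W := by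
  obtain ⟨v, hv, rfl⟩ := hW
  dsimp only
  rw [Matrix.mulVec_smul]
  exact ⟨smul_nonneg hβ hv.1, smul_le_smul_of_nonneg_left hv.2 hβ⟩

theorem smul_U_nonneg {i : V} (hi : i ∈ M.O) {α : ℝ} (hα : 0 ≤ α) {L : Fin m → ℝ}
    (hL : L ∈ α • M.U i) : 0 ≤ L := by
  obtain ⟨v, hv, rfl⟩ := hL
  exact smul_nonneg hα (M.U_nonneg i hi v hv)

theorem mulVec_A_nonneg {i : V} (hi : i ∈ M.O) {L : Fin m → ℝ} (hL : 0 ≤ L) : 0 ≤ M.A i *ᵥ L :=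
  fun k => show 0 ≤ ∑ l, M.A i k l * L l from
    Finset.sum_nonneg fun l _ => mul_nonneg (M.A_nonneg i hi k l) (hL l)

theorem exists_bound_U : ∃ B : Fin m → ℝ, 0 ≤ B ∧ ∀ i ∈ M.O, ∀ α ∈ Set.Icc (0 : ℝ) 1,
    ∀ L ∈ α • M.U i, L ≤ B := by
  have h : ∀ i, ∃ C : Fin m → ℝ, i ∈ M.O → C ∈ upperBounds (M.U i) := fun i => by
    by_cases hi : i ∈ M.O
    · obtain ⟨C, hC⟩ := (M.U_compact i hi).isBounded.bddAbove
      exact ⟨C, fun _ => hC⟩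
    · exact ⟨0, fun h => absurd h hi⟩
  choose C hC using h
  refine ⟨∑ i ∈ M.O, (C i ⊔ 0), Finset.sum_nonneg fun i _ => le_sup_right, ?_⟩
  rintro i hi α hα _ ⟨v, hv, rfl⟩ k
  have h1 : v k ≤ (∑ i ∈ M.O, (C i ⊔ 0)) k :=
    ((hC i hi hv).trans (le_sup_left.trans
      (Finset.single_le_sum (f := fun i => C i ⊔ 0) (fun _ _ => le_sup_right) hi))) k
  have h2 := M.U_nonneg i hi v hv k
  exact (mul_le_of_le_one_left h2 hα.2).trans h1

/-- Balance bounds everything relevant: outputs by compactness of `U`, shipments by outputs,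
consumption by arrivals. The remaining coordinates are truncated, and a lower semicontinuous cost
attains its minimum on the resulting compact set. -/
theorem exists_optimal_plan (hV : ∀ j ∈ M.D, (M.consumptionSet j).Nonempty)
    (hne : ∃ z ∈ M.planSet, M.IsBalanced z) :
    ∃ z ∈ M.planSet, M.IsBalanced z ∧ ∀ z' ∈ M.planSet, M.IsBalanced z' → M.cost z ≤ M.cost z' := by
  obtain ⟨B, hB0, hB⟩ := M.exists_bound_U
  set B' : Fin m → ℝ := ∑ w ∈ M.OD, B with hB'
  have hB'0 : 0 ≤ B' := Finset.sum_nonneg fun _ _ => hB0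
  let box : Set (Plan V m) :=
    (Set.univ.pi fun _ => Set.Icc 0 B) ×ˢ
      (((Set.univ.pi fun _ => Set.Icc 0 1) ×ˢ (Set.univ.pi fun _ => Set.Icc 0 B)) ×ˢ
      ((Set.univ.pi fun _ => Set.Icc 0 1) ×ˢ (Set.univ.pi fun _ => Set.Icc 0 B')))
  have hbox : IsCompact box :=
    (isCompact_univ_pi fun _ => isCompact_Icc).prod
      (((isCompact_univ_pi fun _ => isCompact_Icc).prod (isCompact_univ_pi fun _ => isCompact_Icc)).prod
      ((isCompact_univ_pi fun _ => isCompact_Icc).prod (isCompact_univ_pi fun _ => isCompact_Icc)))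
  let graph : V → Set (ℝ × (Fin m → ℝ)) := fun i =>
    (fun a : ℝ × (Fin m → ℝ) => (a.1, a.1 • a.2)) '' (Set.Icc 0 1 ×ˢ M.U i)
  -- Closedness of the producers' constraint comes from the compact image `graph`. The sets `β •
  -- V_j` need not vary closedly at `β = 0` when `V_j` is unbounded, so the consumers' constraint is
  -- relaxed to a closed linear inequality.
  let F : Set (Plan V m) := {z | M.IsBalanced z} ∩
    ((⋂ i ∈ M.O, {z | (z.2.1.1 i, z.2.1.2 i) ∈ graph i}) ∩
      ⋂ j ∈ M.D, {z | z.2.2.1 j • M.req j ≤ M.Q j *ᵥ z.2.2.2 j})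
  have hF : IsClosed F := by
    refine M.isClosed_isBalanced.inter ((isClosed_biInter fun i hi => ?_).inter
      (isClosed_biInter fun j _ => isClosed_le (by fun_prop) (by fun_prop)))
    have : IsCompact (graph i) := (isCompact_Icc.prod (M.U_compact i hi)).image (by fun_prop)
    exact this.isClosed.preimage (by fun_prop)
  have hK : IsCompact (box ∩ F) := hbox.inter_right hF
  have htrunc : ∀ z ∈ M.planSet, M.IsBalanced z → M.truncate z ∈ box ∩ F := by
    intro z hz hbal
    have hL : ∀ i ∈ M.O, 0 ≤ z.2.1.2 i ∧ z.2.1.2 i ≤ B := fun i hi =>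
      ⟨M.smul_U_nonneg hi (hz.2.1 i hi).1.1 (hz.2.1 i hi).2, hB i hi _ (hz.2.1 i hi).1 _ (hz.2.1 i hi).2⟩
    have hd : ∀ w ∈ M.OD, z.1 w ≤ B := fun w hw => by
      have hwO := (Finset.mem_product.1 (M.OD_subset hw)).1
      refine le_trans ?_ ((sub_nonpos.1 (hbal.1 w.1 hwO)).trans (hL w.1 hwO).2)
      exact Finset.single_le_sum (f := fun w => z.1 w)
        (fun w hw => hz.1 w (Finset.mem_filter.1 hw).1) (Finset.mem_filter.2 ⟨hw, rfl⟩)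
    have hW : ∀ j ∈ M.D, 0 ≤ z.2.2.2 j ∧ z.2.2.2 j ≤ B' := fun j hj => by
      refine ⟨(M.smul_consumptionSet_subset (hz.2.2 j hj).1.1 (hz.2.2 j hj).2).1, ?_⟩
      have h1 : z.2.2.2 j ≤ M.need z.2.1.2 z.2.2.2 j := by
        unfold need
        split_ifs with hO
        · refine le_add_of_nonneg_right (M.mulVec_A_nonneg hO (hL j hO).1)
        · simp
      refine h1.trans ((sub_nonpos.1 (hbal.2.1 j hj)).trans ?_)
      exact (Finset.sum_le_sum fun w hw => hd w (Finset.mem_filter.1 hw).1).trans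
        (Finset.sum_le_sum_of_subset_of_nonneg (Finset.filter_subset _ _) fun _ _ _ => hB0)
    refine ⟨⟨fun w _ => ?_, ⟨fun i _ => ?_, fun i _ => ?_⟩, fun j _ => ?_, fun j _ => ?_⟩,
      M.isBalanced_truncate hbal, ?_, ?_⟩
    · by_cases hw : w ∈ M.OD
      · simpa [truncate, hw] using ⟨hz.1 w hw, hd w hw⟩
      · simpa [truncate, hw] using hB0
    · by_cases hi : i ∈ M.O
      · simpa [truncate, hi] using (hz.2.1 i hi).1
      · simp [truncate, hi]
    · by_cases hi : i ∈ M.O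
      · simpa [truncate, hi] using hL i hi
      · simpa [truncate, hi] using hB0
    · by_cases hj : j ∈ M.D
      · simpa [truncate, hj] using (hz.2.2 j hj).1
      · simp [truncate, hj]
    · by_cases hj : j ∈ M.D
      · simpa [truncate, hj] using hW j hj
      · simpa [truncate, hj] using hB'0
    · refine Set.mem_iInter₂.2 fun i hi => ?_
      obtain ⟨hα, u, hu, he⟩ := hz.2.1 i hi
      refine ⟨(z.2.1.1 i, u), ⟨hα, hu⟩, ?_⟩
      simpa [truncate, hi] using he
    · refine Set.mem_iInter₂.2 fun j hj => ?_
      have := (M.smul_consumptionSet_subset (hz.2.2 j hj).1.1 (hz.2.2 j hj).2).2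
      simpa [truncate, hj] using this
  have hlsc : LowerSemicontinuousOn M.cost (box ∩ F) := by
    refine M.continuous_baseCost.lowerSemicontinuous.lowerSemicontinuousOn _ |>.add ?_
    have hc : Continuous fun z : Plan V m => total z.1 := by
      unfold total
      fun_prop
    refine M.lowerSemicontinuousOn_Φ.comp hc.continuousOn fun z hz => ?_
    exact M.total_nonneg fun w _ => (hz.1.1 w trivial).1
  obtain ⟨z₀, hz₀, hbal₀⟩ := hne
  obtain ⟨z, hz, hmin⟩ := hlsc.exists_isMinOn ⟨_, htrunc z₀ hz₀ hbal₀⟩ hK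
  obtain ⟨⟨hzd, ⟨-, -⟩, hzβ, hzW⟩, hzbal, hzU, hzV⟩ := hz
  have hW0 : ∀ j, 0 ≤ z.2.2.2 j := fun j => (hzW j trivial).1
  -- Consumption at level zero is reset to zero to undo the relaxation. This only lowers needs, and
  -- the cost does not depend on the bundles.
  refine ⟨(z.1, z.2.1, z.2.2.1, fun j => if z.2.2.1 j = 0 then 0 else z.2.2.2 j),
    ⟨fun w _ => (hzd w trivial).1, fun i hi => ?_, fun j hj => ⟨hzβ j trivial, ?_⟩⟩,
    ⟨hzbal.1, fun j hj => ?_, hzbal.2.2⟩, fun z' hz' hbal' => ?_⟩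
  · obtain ⟨⟨α, u⟩, ⟨hα, hu⟩, he⟩ := Set.mem_iInter₂.1 hzU i hi
    obtain ⟨h1, h2⟩ := Prod.mk.inj he
    dsimp only at h1 h2 ⊢
    rw [← h1, ← h2]
    exact ⟨hα, Set.smul_mem_smul_set hu⟩
  · dsimp only
    split_ifs with h
    · rw [h, M.zero_smul_consumptionSet (hV j hj)]
    · exact (M.mem_smul_consumptionSet ((hzβ j trivial).1.lt_of_ne' h)).2
        ⟨hW0 j, Set.mem_iInter₂.1 hzV j hj⟩
  · refine le_trans ?_ (hzbal.2.1 j hj)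
    refine sub_le_sub_right (add_le_add_left ?_ _) _
    dsimp only
    split_ifs
    exacts [hW0 j, le_rfl]
  · have := hmin (htrunc z' hz' hbal')
    rw [Set.mem_ofPred_eq, cost_truncate] at this
    exact this

/-! ### A strictly feasible plan -/

theorem need_nonneg {L W : V → Fin m → ℝ} (hL : ∀ i ∈ M.O, 0 ≤ L i) (hW : ∀ j ∈ M.D, 0 ≤ W j)
    {j : V} (hj : j ∈ M.D) : 0 ≤ M.need L W j := by
  unfold need
  split_ifs with hO
  · exact add_nonneg (hW j hj) (M.mulVec_A_nonneg hO (hL j hO))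
  · simpa using hW j hj

theorem sum_need (L W : V → Fin m → ℝ) :
    ∑ j ∈ M.D, M.need L W j = ∑ i ∈ M.O, M.A i *ᵥ L i + ∑ j ∈ M.D, W j := by
  have h : ∑ j ∈ M.D, (if j ∈ M.O then M.A j *ᵥ L j else 0) = ∑ i ∈ M.O, M.A i *ᵥ L i := by
    rw [← Finset.sum_subset M.O_subset_D fun j _ hj => by simp [hj]]
    exact Finset.sum_congr rfl fun i hi => by simp [hi]
  simp only [need, Finset.sum_add_distrib, h]
  rw [add_comm]

theorem outflow_of_complete (h : M.OD = M.O ×ˢ M.D) (d : V × V → Fin m → ℝ) {i : V}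
    (hi : i ∈ M.O) : M.outflow d i = ∑ j ∈ M.D, d (i, j) := by
  rw [outflow, h, Finset.sum_filter, Finset.sum_product, Finset.sum_eq_single_of_mem i hi]
  · simp
  · intro i' _ hne
    simp [hne]

theorem inflow_of_complete (h : M.OD = M.O ×ˢ M.D) (d : V × V → Fin m → ℝ) {j : V}
    (hj : j ∈ M.D) : M.inflow d j = ∑ i ∈ M.O, d (i, j) := by
  rw [inflow, h, Finset.sum_filter, Finset.sum_product_right, Finset.sum_eq_single_of_mem j hj]
  · simp
  · intro j' _ hne
    simp [hne]

variable {M} in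
/-- A productive plan can be shipped; if every origin serves every destination, proportional
shipments do. -/
theorem IsProductivePlan.exists_shipment {L W : V → Fin m → ℝ} (hp : M.IsProductivePlan L W)
    (hs : M.IsShippable L W) : ∃ d ∈ M.shipments, (∀ i ∈ M.O, M.outflow d i ≤ L i) ∧
      ∀ j ∈ M.D, ∀ k, M.need L W j k < M.inflow d j k := by
  rcases hs with hOD | hs
  swap
  · exact hs
  have hL : ∀ i ∈ M.O, 0 ≤ L i := fun i hi => M.U_nonneg i hi _ (hp.mem_U i hi)
  have hW : ∀ j ∈ M.D, 0 ≤ W j := fun j hj => (hp.mem_V j hj).1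
  have hN : ∀ j ∈ M.D, ∀ k, 0 ≤ M.need L W j k := fun j hj => M.need_nonneg hL hW hj
  set S : Fin m → ℝ := fun k => ∑ i ∈ M.O, L i k with hS
  have hlt : ∀ k, ∑ j ∈ M.D, M.need L W j k < S k := fun k => by
    have h := hp.goods k
    rw [← sum_need] at h
    simpa using h
  have hSpos : ∀ k, 0 < S k := fun k =>
    (Finset.sum_nonneg fun j hj => hN j hj k).trans_lt (hlt k)
  -- The aggregate surplus is split equally among destinations. The proportional shipments then use
  -- up each `L i` exactly and exceed each need by `η`.
  set η : Fin m → ℝ := fun k => (S k - ∑ j ∈ M.D, M.need L W j k) / M.D.card with hη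
  have hcard : ∀ {j}, j ∈ M.D → (0 : ℝ) < M.D.card := fun hj =>
    Nat.cast_pos.2 (Finset.card_pos.2 ⟨_, hj⟩)
  have hηpos : ∀ {j}, j ∈ M.D → ∀ k, 0 < η k := fun hj k => div_pos (sub_pos.2 (hlt k)) (hcard hj)
  refine ⟨fun w k => L w.1 k * (M.need L W w.2 k + η k) / S k, fun w hw k => ?_, fun i hi k => ?_,
    fun j hj k => ?_⟩
  · obtain ⟨h1, h2⟩ := Finset.mem_product.1 (M.OD_subset hw)
    exact div_nonneg (mul_nonneg (hL _ h1 k) (add_nonneg (hN _ h2 k) (hηpos h2 k).le)) (hSpos k).le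
  · rw [M.outflow_of_complete hOD _ hi, Finset.sum_apply]
    dsimp only
    rw [← Finset.sum_div, ← Finset.mul_sum, Finset.sum_add_distrib, Finset.sum_const, nsmul_eq_mul,
      hη]
    dsimp only
    rw [mul_div_cancel₀ _ (hcard (M.O_subset_D hi)).ne', add_sub_cancel,
      mul_div_cancel_right₀ _ (hSpos k).ne']
  · rw [M.inflow_of_complete hOD _ hj, Finset.sum_apply]
    dsimp only
    rw [← Finset.sum_div, ← Finset.sum_mul, mul_div_cancel_left₀ _ (hSpos k).ne']
    linarith [hηpos hj k]

/-- The good `k` is never produced at `i`. -/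
def IsIdle (i : V) (k : Fin m) : Prop := ∀ L ∈ M.U i, L k = 0

/-- The feasible plans that ship no good from an origin where it is never produced. -/
def restrictedPlans : Set (Plan V m) :=
  {z | z ∈ M.planSet ∧ ∀ w ∈ M.OD, ∀ k, M.IsIdle w.1 k → z.1 w k = 0}

theorem convex_restrictedPlans : Convex ℝ M.restrictedPlans := by
  refine fun z hz z' hz' a b ha hb hab => ⟨M.convex_planSet hz.1 hz'.1 ha hb hab,
    fun w hw k hk => ?_⟩
  simp [hz.2 w hw k hk, hz'.2 w hw k hk]

/-- Averaging with an output positive in a new coordinate keeps the earlier positive ones positive,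
since outputs are nonnegative and `U i` is convex. -/
theorem exists_active_output {i : V} (hi : i ∈ M.O) (hne : (M.U i).Nonempty) :
    ∃ L ∈ M.U i, ∀ k, ¬ M.IsIdle i k → 0 < L k := by
  classical
  suffices h : ∀ s : Finset (Fin m), ∃ L ∈ M.U i, ∀ k ∈ s, ¬ M.IsIdle i k → 0 < L k by
    obtain ⟨L, hL, h⟩ := h Finset.univ
    exact ⟨L, hL, fun k => h k (Finset.mem_univ k)⟩
  intro s
  induction s using Finset.induction_on with
  | empty => exact ⟨hne.some, hne.some_mem, by simp⟩
  | insert k s _ ih =>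
    obtain ⟨L, hL, h⟩ := ih
    by_cases hk : M.IsIdle i k
    · refine ⟨L, hL, fun k' hk' hact => ?_⟩
      rcases Finset.mem_insert.1 hk' with rfl | hk'
      exacts [absurd hk hact, h k' hk' hact]
    · unfold IsIdle at hk
      push Not at hk
      obtain ⟨L', hL', hk⟩ := hk
      have hL'0 := M.U_nonneg i hi L' hL'
      have hL0 := M.U_nonneg i hi L hL
      refine ⟨(1 / 2 : ℝ) • L + (1 / 2 : ℝ) • L',
        M.U_convex i hi hL hL' (by norm_num) (by norm_num) (by norm_num), fun k' hk' hact => ?_⟩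
      have h1 : 0 ≤ L k' := hL0 k'
      have h2 : 0 ≤ L' k' := hL'0 k'
      simp only [Pi.add_apply, Pi.smul_apply, smul_eq_mul]
      rcases Finset.mem_insert.1 hk' with rfl | hk'
      · have := h2.lt_of_ne' hk
        linarith
      · have := h k' hk' hact
        linarith

theorem eventually_combo_neg {a : ℝ} (ha : a < 0) (c : ℝ) :
    ∀ᶠ ε : ℝ in 𝓝[Set.Ioc 0 1] 0, (1 - ε) * a + ε * c < 0 := by
  have h : Tendsto (fun ε : ℝ => (1 - ε) * a + ε * c) (𝓝 0) (𝓝 ((1 - 0) * a + 0 * c)) :=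
    Continuous.tendsto (by fun_prop) 0
  exact (h.mono_left nhdsWithin_le_nhds).eventually (gt_mem_nhds (by simpa using ha))

theorem mem_restrictedPlans_of_outflow_le {d : V × V → Fin m → ℝ} (hd : d ∈ M.shipments)
    {L W : V → Fin m → ℝ} (hL : ∀ i ∈ M.O, L i ∈ M.U i) (hW : ∀ j ∈ M.D, W j ∈ M.consumptionSet j)
    (h : ∀ i ∈ M.O, M.outflow d i ≤ L i) :
    ((d, ((fun _ => 1), L), ((fun _ => 1), W)) : Plan V m) ∈ M.restrictedPlans := by
  refine ⟨⟨hd, fun i hi => ⟨by simp, by simpa using hL i hi⟩,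
    fun j hj => ⟨by simp, by simpa using hW j hj⟩⟩, fun w hw k hk => ?_⟩
  have hwO := (Finset.mem_product.1 (M.OD_subset hw)).1
  refine le_antisymm ?_ (hd w hw k)
  have h1 : d w ≤ M.outflow d w.1 := Finset.single_le_sum (f := fun w => d w)
    (fun w hw => hd w (Finset.mem_filter.1 hw).1) (Finset.mem_filter.2 ⟨hw, rfl⟩)
  exact ((h1.trans (h w.1 hwO)) k).trans_eq (hk _ (hL w.1 hwO))

variable {M} in
-- The shipped productive plan is strict except possibly at origins. A small admixture of a plan
-- that ships nothing and has positive output of every non-idle good makes those constraints strict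
-- and preserves the other strict ones.
theorem IsProductivePlan.exists_strict_plan {L W : V → Fin m → ℝ} (hp : M.IsProductivePlan L W)
    (hs : M.IsShippable L W) : ∃ z ∈ M.restrictedPlans,
      (∀ i ∈ M.O, ∀ k, ¬ M.IsIdle i k → M.originExcess z i k < 0) ∧
      (∀ j ∈ M.D, ∀ k, M.destExcess z j k < 0) ∧ ∀ k, M.materialExcess z k < 0 := by
  obtain ⟨d, hd, hout, hin⟩ := hp.exists_shipment hs
  have h : ∀ i, ∃ L' : Fin m → ℝ, i ∈ M.O → L' ∈ M.U i ∧ ∀ k, ¬ M.IsIdle i k → 0 < L' k := by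
    intro i
    by_cases hi : i ∈ M.O
    · obtain ⟨L', h1, h2⟩ := M.exists_active_output hi ⟨_, hp.mem_U i hi⟩
      exact ⟨L', fun _ => ⟨h1, h2⟩⟩
    · exact ⟨0, fun h => absurd h hi⟩
  choose L' hL' using h
  set z₁ : Plan V m := (d, ((fun _ => 1), L), ((fun _ => 1), W)) with hz₁
  set z₂ : Plan V m := (0, ((fun _ => 1), L'), ((fun _ => 1), W)) with hz₂
  have hmem₁ : z₁ ∈ M.restrictedPlans :=
    M.mem_restrictedPlans_of_outflow_le hd hp.mem_U hp.mem_V hout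
  have hmem₂ : z₂ ∈ M.restrictedPlans :=
    M.mem_restrictedPlans_of_outflow_le (fun _ _ => le_rfl) (fun i hi => (hL' i hi).1) hp.mem_V
      fun i hi => by simpa [outflow] using M.U_nonneg i hi _ (hL' i hi).1
  have hD : ∀ᶠ ε : ℝ in 𝓝[Set.Ioc 0 1] 0, ∀ j, j ∈ M.D → ∀ k,
      (1 - ε) * M.destExcess z₁ j k + ε * M.destExcess z₂ j k < 0 := by
    refine eventually_all.2 fun j => eventually_imp_distrib_left.2 fun hj => eventually_all.2 fun k =>
      eventually_combo_neg ?_ _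
    exact sub_neg.2 (hin j hj k)
  have hm : ∀ᶠ ε : ℝ in 𝓝[Set.Ioc 0 1] 0, ∀ k,
      (1 - ε) * M.materialExcess z₁ k + ε * M.materialExcess z₂ k < 0 :=
    eventually_all.2 fun k => eventually_combo_neg (sub_neg.2 (hp.materials k)) _
  obtain ⟨ε, hε, hεD, hεm⟩ :=
    (Filter.Eventually.and (eventually_mem_nhdsWithin (a := (0 : ℝ)) (s := Set.Ioc 0 1))
      (hD.and hm)).exists
  refine ⟨(1 - ε) • z₁ + ε • z₂, M.convex_restrictedPlans hmem₁ hmem₂ (sub_nonneg.2 hε.2) hε.1.le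
    (sub_add_cancel 1 ε), fun i hi k hk => ?_, fun j hj k => ?_, fun k => ?_⟩
  · rw [originExcess_combo]
    have h1 : M.originExcess z₁ i k ≤ 0 := sub_nonpos.2 (hout i hi k)
    have h2 : M.originExcess z₂ i k = -L' i k := by simp [originExcess, outflow, hz₂]
    simp only [Pi.add_apply, Pi.smul_apply, smul_eq_mul, h2]
    nlinarith [mul_pos hε.1 ((hL' i hi).2 k hk),
      mul_nonneg (sub_nonneg.2 hε.2) (neg_nonneg.2 h1)]
  · rw [destExcess_combo]
    exact hεD j hj k
  · rw [M.materialExcess_combo _ _ (sub_add_cancel 1 ε)]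
    exact hεm k

/-! ### Multipliers for the balance inequalities -/

theorem originExcess_of_idle {z : Plan V m} (hz : z ∈ M.restrictedPlans) {i : V} (hi : i ∈ M.O)
    {k : Fin m} (hk : M.IsIdle i k) : M.originExcess z i k = 0 := by
  obtain ⟨u, hu, he⟩ := (hz.1.2.1 i hi).2
  have h1 : z.2.1.2 i k = 0 := by
    rw [← he]
    simp [hk u hu]
  have h2 : M.outflow z.1 i k = 0 := by
    rw [outflow, Finset.sum_apply]
    refine Finset.sum_eq_zero fun w hw => ?_
    obtain ⟨hw', rfl⟩ := Finset.mem_filter.1 hw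
    exact hz.2 w hw' k hk
  simp [originExcess, h1, h2]

/-- The constraints of the program over the restricted plans; the constraints that do not matter are
replaced by a strictly satisfied one. -/
noncomputable def constraint : (V × Fin m) ⊕ (V × Fin m) ⊕ Fin q → Plan V m → ℝ :=
  open scoped Classical in
  Sum.elim (fun a z => if a.1 ∈ M.O ∧ ¬ M.IsIdle a.1 a.2 then M.originExcess z a.1 a.2 else -1)
    (Sum.elim (fun a z => if a.1 ∈ M.D then M.destExcess z a.1 a.2 else -1)
      fun k z => M.materialExcess z k)

theorem convexOn_constraint (l : (V × Fin m) ⊕ (V × Fin m) ⊕ Fin q) :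
    ConvexOn ℝ M.restrictedPlans (M.constraint l) := by
  refine ⟨M.convex_restrictedPlans, fun z _ z' _ a b _ _ hab => le_of_eq ?_⟩
  have h1 : (-1 : ℝ) = a * -1 + b * -1 := by linarith
  rcases l with l | l | k <;> simp only [constraint, Sum.elim_inl, Sum.elim_inr, smul_eq_mul]
  · split_ifs
    · rw [originExcess_combo]
      rfl
    · exact h1
  · split_ifs
    · rw [destExcess_combo]
      rfl
    · exact h1
  · rw [M.materialExcess_combo _ _ hab]
    rfl

theorem isBalanced_of_constraint {z : Plan V m} (hz : z ∈ M.restrictedPlans)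
    (h : ∀ l, M.constraint l z ≤ 0) : M.IsBalanced z := by
  refine ⟨fun i hi k => ?_, fun j hj k => ?_, fun k => h (Sum.inr (Sum.inr k))⟩
  · by_cases hk : M.IsIdle i k
    · exact (M.originExcess_of_idle hz hi hk).le
    · simpa [constraint, hi, hk] using h (Sum.inl (i, k))
  · simpa [constraint, hj] using h (Sum.inr (Sum.inl (j, k)))

/-- The part of a vector `d` in the coordinates satisfying `P` can be moved to another coordinate, or
removed, so that the cost does not grow, if the prices `a` are large in the coordinates in `P`. -/
theorem exists_reduced_vector (P : Fin m → Prop) {a d : Fin m → ℝ} (hd : 0 ≤ d) {B : ℝ}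
    (haB : ∀ k, P k → B ≤ a k) (ha : ∀ k l, P k → ¬ P l → a l ≤ a k) :
    ∃ v : Fin m → ℝ, 0 ≤ v ∧ (∀ k, P k → v k = 0) ∧ ∑ k, v k ≤ ∑ k, d k ∧
      ((∃ l, ¬ P l) → ∑ k, v k = ∑ k, d k) ∧
      a ⬝ᵥ v + B * (∑ k, d k - ∑ k, v k) ≤ a ⬝ᵥ d := by
  classical
  by_cases hl : ∃ l, ¬ P l
  · obtain ⟨l, hl⟩ := hl
    -- The whole amount in the forbidden coordinates is moved to a single allowed one, preserving
    -- the total.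
    set c : ℝ := ∑ k, if P k then d k else 0 with hc
    set u : Fin m → ℝ := fun k => if P k then 0 else d k with hu
    have hc0 : 0 ≤ c := Finset.sum_nonneg fun k _ => by
      split_ifs
      exacts [hd k, le_rfl]
    have hu0 : 0 ≤ u := fun k => by
      simp only [hu]
      split_ifs
      exacts [le_rfl, hd k]
    have hsum : ∑ k, (u + (Pi.single l c : Fin m → ℝ)) k = ∑ k, d k := by
      simp only [Pi.add_apply, Finset.sum_add_distrib, Finset.sum_pi_single', Finset.mem_univ,
        if_true, hc]
      rw [← Finset.sum_add_distrib]
      exact Finset.sum_congr rfl fun k _ => by simp only [hu]; split_ifs <;> simp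
    refine ⟨u + Pi.single l c, add_nonneg hu0 (Pi.single_nonneg.2 hc0), fun k hk => ?_, hsum.le,
      fun _ => hsum, ?_⟩
    · have : k ≠ l := fun h => hl (h ▸ hk)
      simp [hu, hk, this]
    · rw [hsum, sub_self, mul_zero, add_zero, dotProduct_add, dotProduct_single, hc, Finset.mul_sum,
        dotProduct, dotProduct, ← Finset.sum_add_distrib]
      refine Finset.sum_le_sum fun k _ => ?_
      by_cases hk : P k
      · simpa [hu, hk] using mul_le_mul_of_nonneg_right (ha k l hk hl) (hd k)
      · simp [hu, hk]
  · push Not at hl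
    -- With no allowed coordinate everything is dropped; the price bound `B` pays for the lost
    -- total.
    refine ⟨0, le_rfl, fun _ _ => rfl, ?_, fun ⟨l, h⟩ => absurd (hl l) h, ?_⟩
    · simpa using Finset.sum_nonneg fun k _ => hd k
    · simp only [dotProduct_zero, Pi.zero_apply, Finset.sum_const_zero, sub_zero, zero_add]
      rw [Finset.mul_sum, dotProduct]
      exact Finset.sum_le_sum fun k _ => mul_le_mul_of_nonneg_right (haB k (hl k)) (hd k)

theorem trade_eq (pL pW : V → Fin m → ℝ) (d : V × V → Fin m → ℝ) :
    ∑ i ∈ M.O, pL i ⬝ᵥ M.outflow d i - ∑ j ∈ M.D, pW j ⬝ᵥ M.inflow d j =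
      ∑ w ∈ M.OD, (pL w.1 - pW w.2) ⬝ᵥ d w := by
  have h1 : ∑ i ∈ M.O, pL i ⬝ᵥ M.outflow d i = ∑ w ∈ M.OD, pL w.1 ⬝ᵥ d w := by
    rw [← Finset.sum_fiberwise_of_maps_to (g := Prod.fst)
      fun w hw => (Finset.mem_product.1 (M.OD_subset hw)).1]
    refine Finset.sum_congr rfl fun i _ => ?_
    rw [outflow, dotProduct_sum]
    exact Finset.sum_congr rfl fun w hw => by rw [(Finset.mem_filter.1 hw).2]
  have h2 : ∑ j ∈ M.D, pW j ⬝ᵥ M.inflow d j = ∑ w ∈ M.OD, pW w.2 ⬝ᵥ d w := by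
    rw [← Finset.sum_fiberwise_of_maps_to (g := Prod.snd)
      fun w hw => (Finset.mem_product.1 (M.OD_subset hw)).2]
    refine Finset.sum_congr rfl fun i _ => ?_
    rw [inflow, dotProduct_sum]
    exact Finset.sum_congr rfl fun w hw => by rw [(Finset.mem_filter.1 hw).2]
  simp only [h1, h2, sub_dotProduct, Finset.sum_sub_distrib]

/-- If the prices of the goods that are never produced at an origin are large, then restricting the
shipments to produced goods does not increase the Lagrangian. -/
theorem exists_restricted_plan (hU : 0 < M.γ → ∀ w ∈ M.OD, ∃ L ∈ M.U w.1, L ≠ 0)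
    {π : Prices V m q}
    (hB : ∀ w ∈ M.OD, ∀ k, M.IsIdle w.1 k → ∑ e, |M.tbar e| ≤ π.1 w.1 k - π.2.1 w.2 k)
    (hπ : ∀ w ∈ M.OD, ∀ k l, M.IsIdle w.1 k → ¬ M.IsIdle w.1 l →
      π.1 w.1 l - π.2.1 w.2 l ≤ π.1 w.1 k - π.2.1 w.2 k) {z : Plan V m} (hz : z ∈ M.planSet) :
    ∃ z' ∈ M.restrictedPlans, M.cost z' + M.pairing π z' ≤ M.cost z + M.pairing π z := by
  have h : ∀ w, ∃ v : Fin m → ℝ, w ∈ M.OD → 0 ≤ v ∧ (∀ k, M.IsIdle w.1 k → v k = 0) ∧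
      ∑ k, v k ≤ ∑ k, z.1 w k ∧ ((∃ l, ¬ M.IsIdle w.1 l) → ∑ k, v k = ∑ k, z.1 w k) ∧
      (π.1 w.1 - π.2.1 w.2) ⬝ᵥ v + (∑ e, |M.tbar e|) * (∑ k, z.1 w k - ∑ k, v k) ≤
        (π.1 w.1 - π.2.1 w.2) ⬝ᵥ z.1 w := by
    intro w
    by_cases hw : w ∈ M.OD
    · obtain ⟨v, hv⟩ := exists_reduced_vector (M.IsIdle w.1) (a := π.1 w.1 - π.2.1 w.2)
        (hz.1 w hw) (hB w hw) (hπ w hw)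
      exact ⟨v, fun _ => hv⟩
    · exact ⟨0, fun h => absurd h hw⟩
  choose d hd using h
  refine ⟨(d, z.2), ⟨⟨fun w hw => (hd w hw).1, hz.2⟩, fun w hw => (hd w hw).2.1⟩, ?_⟩
  -- The function `x log x` is not monotone, so for `γ > 0` totals must be preserved. The nonzero
  -- output in `hU` supplies a non-idle good to which shipments can be moved.
  have hent : M.entropy d = M.entropy z.1 := by
    rcases M.γ_nonneg.eq_or_lt with hγ | hγ
    · simp [entropy, ← hγ]
    · rw [entropy, entropy]
      congr 1
      refine Finset.sum_congr rfl fun w hw => ?_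
      have : total d w = total z.1 w := (hd w hw).2.2.2.1 (by
        obtain ⟨L, hL, hne⟩ := hU hγ w hw
        obtain ⟨l, hl⟩ := Function.ne_iff.1 hne
        exact ⟨l, fun h => hl (h L hL)⟩)
      rw [this]
  have hΦ := M.Φ_le_add (s := total z.1) (s' := total d) (M.total_nonneg hz.1)
    (M.total_nonneg fun w hw => (hd w hw).1) fun w hw => (hd w hw).2.2.1
  have hsum := Finset.sum_le_sum fun w hw => (hd w hw).2.2.2.2
  rw [Finset.sum_add_distrib, ← M.trade_eq, ← M.trade_eq] at hsum
  have hpair : ∀ d' : V × V → Fin m → ℝ, M.pairing π (d', z.2) =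
      (∑ i ∈ M.O, π.1 i ⬝ᵥ M.outflow d' i - ∑ j ∈ M.D, π.2.1 j ⬝ᵥ M.inflow d' j)
      - ∑ i ∈ M.O, π.1 i ⬝ᵥ z.2.1.2 i + ∑ j ∈ M.D, π.2.1 j ⬝ᵥ M.need z.2.1.2 z.2.2.2 j
      + π.2.2 ⬝ᵥ M.materialExcess z := fun d' => by
    simp only [pairing, originExcess, destExcess, dotProduct_sub, Finset.sum_sub_distrib,
      materialExcess]
    ring
  have hz' := hpair z.1
  rw [Prod.mk.eta] at hz'
  rw [hpair, hz']
  simp only [cost, baseCost, hent]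
  simp only [total] at hΦ ⊢
  linarith

/-- Under the productivity condition, a lower bound of the social cost of the balanced plans is, for
suitable prices, a lower bound of the Lagrangian over all feasible plans. -/
theorem exists_prices {L W : V → Fin m → ℝ} (hp : M.IsProductivePlan L W)
    (hs : M.IsShippable L W) (hU : 0 < M.γ → ∀ w ∈ M.OD, ∃ L ∈ M.U w.1, L ≠ 0) {c : ℝ}
    (hc : ∀ z ∈ M.planSet, M.IsBalanced z → c ≤ M.cost z) :
    ∃ π ∈ M.priceSet, ∀ z ∈ M.planSet, c ≤ M.cost z + M.pairing π z := by
  classical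
  obtain ⟨z₀, hz₀, hO, hD, hm⟩ := hp.exists_strict_plan hs
  obtain ⟨p, hp0, hpc⟩ := exists_lagrange_multipliers (f := M.cost) (G := M.constraint)
    (M.convexOn_cost.subset (fun z hz => hz.1) M.convex_restrictedPlans) M.convexOn_constraint
    (fun z hz h => hc z hz.1 (M.isBalanced_of_constraint hz h)) hz₀ (by
      rintro (⟨i, k⟩ | ⟨j, k⟩ | k)
      · by_cases h : i ∈ M.O ∧ ¬ M.IsIdle i k
        · simpa [constraint, h] using hO i h.1 k h.2
        · simp [constraint, h]
      · by_cases h : j ∈ M.D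
        · simpa [constraint, h] using hD j h k
        · simp [constraint, h]
      · exact hm k)
  set B := ∑ e, |M.tbar e| with hB
  have hB0 : 0 ≤ B := Finset.sum_nonneg fun e _ => abs_nonneg _
  -- Dominating all multipliers for goods plus `B`, this price keeps idle goods at least `B` above
  -- any destination price and no cheaper to trade than non-idle ones.
  set K : ℝ := ∑ a, p (Sum.inl a) + ∑ a, p (Sum.inr (Sum.inl a)) + B with hK
  have hle₁ : ∀ a, p (Sum.inl a) ≤ ∑ a, p (Sum.inl a) := fun a =>
    Finset.single_le_sum (f := fun a => p (Sum.inl a)) (fun a _ => hp0 _) (Finset.mem_univ a)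
  have hle₂ : ∀ a, p (Sum.inr (Sum.inl a)) ≤ ∑ a, p (Sum.inr (Sum.inl a)) := fun a =>
    Finset.single_le_sum (f := fun a => p (Sum.inr (Sum.inl a))) (fun a _ => hp0 _)
      (Finset.mem_univ a)
  have hnn₁ : 0 ≤ ∑ a, p (Sum.inl a) := Finset.sum_nonneg fun a _ => hp0 _
  have hnn₂ : 0 ≤ ∑ a, p (Sum.inr (Sum.inl a)) := Finset.sum_nonneg fun a _ => hp0 _
  have hK0 : 0 ≤ K := by linarith
  let π : Prices V m q := (fun i k => if M.IsIdle i k then K else p (Sum.inl (i, k)),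
    fun j k => p (Sum.inr (Sum.inl (j, k))), fun k => p (Sum.inr (Sum.inr k)))
  -- Only an inequality: the dummy constraints contribute `-p l ≤ 0`, while the price `K` multiplies
  -- an excess that vanishes on restricted plans.
  have hpair : ∀ z ∈ M.restrictedPlans, ∑ l, p l * M.constraint l z ≤ M.pairing π z := by
    intro z hz
    rw [Fintype.sum_sum_type, Fintype.sum_sum_type, Fintype.sum_prod_type, Fintype.sum_prod_type,
      pairing, add_assoc]
    refine add_le_add ?_ (add_le_add ?_ le_rfl)
    · rw [← Fintype.sum_ite_mem M.O]
      refine Finset.sum_le_sum fun i _ => ?_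
      by_cases hi : i ∈ M.O
      · rw [if_pos hi, dotProduct]
        refine Finset.sum_le_sum fun k _ => ?_
        by_cases hk : M.IsIdle i k
        · simpa [constraint, hk, M.originExcess_of_idle hz hi hk] using hp0 (Sum.inl (i, k))
        · simp [constraint, hi, hk, π]
      · rw [if_neg hi]
        exact Finset.sum_nonpos fun k _ => by simpa [constraint, hi] using hp0 (Sum.inl (i, k))
    · rw [← Fintype.sum_ite_mem M.D]
      refine Finset.sum_le_sum fun j _ => ?_
      by_cases hj : j ∈ M.D
      · rw [if_pos hj, dotProduct]
        exact Finset.sum_le_sum fun k _ => by simp [constraint, hj, π]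
      · rw [if_neg hj]
        exact Finset.sum_nonpos fun k _ => by
          simpa [constraint, hj] using hp0 (Sum.inr (Sum.inl (j, k)))
  refine ⟨π, ⟨fun i _ k => ?_, fun j _ k => hp0 _, fun k => hp0 _⟩, fun z hz => ?_⟩
  · dsimp only [π]
    split_ifs
    exacts [hK0, hp0 _]
  · have hπB : ∀ w ∈ M.OD, ∀ k, M.IsIdle w.1 k → B ≤ π.1 w.1 k - π.2.1 w.2 k := by
      intro w _ k hk
      have h1 := hle₂ (w.2, k)
      simp only [π, hk, if_true]
      linarith
    have hππ : ∀ w ∈ M.OD, ∀ k l, M.IsIdle w.1 k → ¬ M.IsIdle w.1 l →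
        π.1 w.1 l - π.2.1 w.2 l ≤ π.1 w.1 k - π.2.1 w.2 k := by
      intro w _ k l hk hl
      have h1 := hle₂ (w.2, k)
      have h2 := hle₁ (w.1, l)
      have h3 : 0 ≤ p (Sum.inr (Sum.inl (w.2, l))) := hp0 _
      simp only [π, hk, hl, if_true, if_false]
      linarith
    obtain ⟨z', hz', hle⟩ := M.exists_restricted_plan hU hπB hππ hz
    exact ((hpc z' hz').trans (add_le_add_right (hpair z' hz') _)).trans hle

/-! ### The outer problem -/

/-- Maximizing the saddle function over `t` leaves the Lagrangian, which links the outer problem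
with the Lagrange dual. -/
theorem cost_add_pairing {z : Plan V m} (hz : z.1 ∈ M.shipments) (π : Prices V m q) :
    M.cost z + M.pairing π z = -(π.2.2 ⬝ᵥ M.b)
      - ∑ i ∈ M.O, M.profit π.1 π.2.1 π.2.2 i (z.2.1.1 i) (z.2.1.2 i)
      - ∑ j ∈ M.D, (z.2.2.1 j * M.inc j - π.2.1 j ⬝ᵥ z.2.2.2 j)
      + (M.tradeCost π.1 π.2.1 z.1 + M.innerMax (total z.1)) := by
  obtain ⟨t, -, h⟩ := M.exists_innerObj_eq (M.total_nonneg hz)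
  have h1 := M.saddleFun_eq z (π, t)
  rw [saddleFun] at h1
  dsimp only at h1
  rw [cost, M.innerMax_eq (M.total_nonneg hz), ← h]
  linarith

/-- Profit is homogeneous in the participation level, so optimizing this level over `[0, 1]`
produces the positive part in `producerMax`. -/
theorem profit_smul (π : Prices V m q) (i : V) (α : ℝ) (u : Fin m → ℝ) :
    M.profit π.1 π.2.1 π.2.2 i α (α • u) =
      α * ((π.1 i - M.c i - (M.A i)ᵀ *ᵥ π.2.1 i - (M.R i)ᵀ *ᵥ π.2.2) ⬝ᵥ u - M.χ i) := by
  simp only [profit, sub_dotProduct, Matrix.mulVec_transpose, ← Matrix.dotProduct_mulVec,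
    Matrix.mulVec_smul, dotProduct_smul, smul_eq_mul]
  ring

theorem mul_le_max_zero {α x : ℝ} (hα : α ∈ Set.Icc (0 : ℝ) 1) : α * x ≤ max x 0 := by
  rcases le_total 0 x with hx | hx
  · exact (mul_le_of_le_one_left hx hα.2).trans (le_max_left _ _)
  · exact (mul_nonpos_of_nonneg_of_nonpos hα.1 hx).trans (le_max_right _ _)

theorem profit_le_producerMax (π : Prices V m q) {i : V} (hi : i ∈ M.O) {α : ℝ}
    (hα : α ∈ Set.Icc (0 : ℝ) 1) {L : Fin m → ℝ} (hL : L ∈ α • M.U i) :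
    M.profit π.1 π.2.1 π.2.2 i α L ≤ M.producerMax π i := by
  obtain ⟨u, hu, rfl⟩ := hL
  dsimp only
  rw [profit_smul]
  refine (mul_le_max_zero hα).trans (le_csSup ?_ ⟨u, hu, rfl⟩)
  refine ((M.U_compact i hi).image ?_).bddAbove
  unfold dotProduct
  fun_prop

theorem exists_profit_gt (π : Prices V m q) {i : V} (hne : (M.U i).Nonempty) {ε : ℝ}
    (hε : 0 < ε) : ∃ α ∈ Set.Icc (0 : ℝ) 1, ∃ L ∈ α • M.U i,
      M.producerMax π i - ε < M.profit π.1 π.2.1 π.2.2 i α L := by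
  obtain ⟨_, ⟨u, hu, rfl⟩, h⟩ := exists_lt_of_lt_csSup (hne.image _) (sub_lt_self (M.producerMax π i) hε)
  rcases lt_max_iff.1 h with h | h
  · refine ⟨1, by simp, (1 : ℝ) • u, Set.smul_mem_smul_set hu, ?_⟩
    rwa [profit_smul, one_mul]
  · refine ⟨0, by simp, (0 : ℝ) • u, Set.smul_mem_smul_set hu, ?_⟩
    rwa [profit_smul, zero_mul]

theorem surplus_smul (π : Prices V m q) (j : V) (β : ℝ) (v : Fin m → ℝ) :
    β * M.inc j - π.2.1 j ⬝ᵥ (β • v) = β * (M.inc j - π.2.1 j ⬝ᵥ v) := by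
  rw [dotProduct_smul, smul_eq_mul]
  ring

theorem surplus_le_consumerMax {π : Prices V m q} (hπ : π ∈ M.priceSet) {j : V} (hj : j ∈ M.D)
    {β : ℝ} (hβ : β ∈ Set.Icc (0 : ℝ) 1) {W : Fin m → ℝ} (hW : W ∈ β • M.consumptionSet j) :
    β * M.inc j - π.2.1 j ⬝ᵥ W ≤ M.consumerMax π j := by
  obtain ⟨v, hv, rfl⟩ := hW
  dsimp only
  rw [surplus_smul]
  refine (mul_le_max_zero hβ).trans (le_csSup ⟨max (M.inc j) 0, ?_⟩ ⟨v, hv, rfl⟩)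
  rintro _ ⟨u, hu, rfl⟩
  exact max_le_max_right _ (sub_le_self _ (Finset.sum_nonneg fun k _ =>
    mul_nonneg (hπ.2.1 j hj k) (hu.1 k)))

theorem exists_surplus_gt (π : Prices V m q) {j : V} (hne : (M.consumptionSet j).Nonempty) {ε : ℝ}
    (hε : 0 < ε) : ∃ β ∈ Set.Icc (0 : ℝ) 1, ∃ W ∈ β • M.consumptionSet j,
      M.consumerMax π j - ε < β * M.inc j - π.2.1 j ⬝ᵥ W := by
  obtain ⟨_, ⟨u, hu, rfl⟩, h⟩ := exists_lt_of_lt_csSup (hne.image _) (sub_lt_self (M.consumerMax π j) hε)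
  rcases lt_max_iff.1 h with h | h
  · refine ⟨1, by simp, (1 : ℝ) • u, Set.smul_mem_smul_set hu, ?_⟩
    rwa [surplus_smul, one_mul]
  · refine ⟨0, by simp, (0 : ℝ) • u, Set.smul_mem_smul_set hu, ?_⟩
    rwa [surplus_smul, zero_mul]

/-- Weak duality. -/
theorem outerObj_le {π : Prices V m q} (hπ : π ∈ M.priceSet) {z : Plan V m} (hz : z ∈ M.planSet) :
    M.outerObj π ≤ ((M.cost z + M.pairing π z : ℝ) : EReal) := by
  have h1 : ∑ i ∈ M.O, M.profit π.1 π.2.1 π.2.2 i (z.2.1.1 i) (z.2.1.2 i) ≤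
      ∑ i ∈ M.O, M.producerMax π i := Finset.sum_le_sum fun i hi =>
    M.profit_le_producerMax π hi (hz.2.1 i hi).1 (hz.2.1 i hi).2
  have h2 : ∑ j ∈ M.D, (z.2.2.1 j * M.inc j - π.2.1 j ⬝ᵥ z.2.2.2 j) ≤
      ∑ j ∈ M.D, M.consumerMax π j := Finset.sum_le_sum fun j hj =>
    M.surplus_le_consumerMax hπ hj (hz.2.2 j hj).1 (hz.2.2 j hj).2
  rw [M.cost_add_pairing hz.1, EReal.coe_add]
  exact add_le_add (EReal.coe_le_coe_iff.2 (by linarith)) (iInf₂_le z.1 hz.1)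

/-- For fixed prices and shipments the producers and consumers can be optimized independently.
Choices within `ε` of each supremum suffice, and `ε → 0` removes the error. -/
theorem le_outerObj (hUne : ∀ i ∈ M.O, (M.U i).Nonempty)
    (hV : ∀ j ∈ M.D, (M.consumptionSet j).Nonempty) {π : Prices V m q} {c : ℝ}
    (hc : ∀ z ∈ M.planSet, c ≤ M.cost z + M.pairing π z) : (c : EReal) ≤ M.outerObj π := by
  set r₀ : ℝ := -(π.2.2 ⬝ᵥ M.b) - ∑ i ∈ M.O, M.producerMax π i - ∑ j ∈ M.D, M.consumerMax π j
    with hr₀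
  have key : ∀ d ∈ M.shipments, c - r₀ ≤ M.tradeCost π.1 π.2.1 d + M.innerMax (total d) := by
    intro d hd
    have hε : ∀ ε : ℝ, 0 < ε →
        c - r₀ ≤ M.tradeCost π.1 π.2.1 d + M.innerMax (total d) + (M.O.card + M.D.card) * ε := by
      intro ε hε
      have hP : ∀ i, ∃ a : ℝ × (Fin m → ℝ), i ∈ M.O → a.1 ∈ Set.Icc (0 : ℝ) 1 ∧ a.2 ∈ a.1 • M.U i ∧
          M.producerMax π i - ε < M.profit π.1 π.2.1 π.2.2 i a.1 a.2 := fun i => by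
        by_cases hi : i ∈ M.O
        · obtain ⟨α, hα, L, hL, h⟩ := M.exists_profit_gt π (hUne i hi) hε
          exact ⟨(α, L), fun _ => ⟨hα, hL, h⟩⟩
        · exact ⟨0, fun h => absurd h hi⟩
      have hC : ∀ j, ∃ a : ℝ × (Fin m → ℝ), j ∈ M.D → a.1 ∈ Set.Icc (0 : ℝ) 1 ∧
          a.2 ∈ a.1 • M.consumptionSet j ∧
          M.consumerMax π j - ε < a.1 * M.inc j - π.2.1 j ⬝ᵥ a.2 := fun j => by
        by_cases hj : j ∈ M.D
        · obtain ⟨β, hβ, W, hW, h⟩ := M.exists_surplus_gt π (hV j hj) hε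
          exact ⟨(β, W), fun _ => ⟨hβ, hW, h⟩⟩
        · exact ⟨0, fun h => absurd h hj⟩
      choose P hP using hP
      choose C hC using hC
      have h := hc (d, (fun i => (P i).1, fun i => (P i).2), (fun j => (C j).1, fun j => (C j).2))
        ⟨hd, fun i hi => ⟨(hP i hi).1, (hP i hi).2.1⟩, fun j hj => ⟨(hC j hj).1, (hC j hj).2.1⟩⟩
      rw [M.cost_add_pairing hd] at h
      have h1 := Finset.sum_le_sum fun i hi => (hP i hi).2.2.le
      have h2 := Finset.sum_le_sum fun j hj => (hC j hj).2.2.le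
      rw [Finset.sum_sub_distrib, Finset.sum_const, nsmul_eq_mul] at h1 h2
      dsimp only at h
      linarith
    have hlim : Tendsto (fun ε : ℝ => M.tradeCost π.1 π.2.1 d + M.innerMax (total d) +
        (M.O.card + M.D.card) * ε) (𝓝[>] 0) (𝓝 (M.tradeCost π.1 π.2.1 d + M.innerMax (total d) +
        (M.O.card + M.D.card) * 0)) :=
      (Continuous.tendsto (by fun_prop) 0).mono_left nhdsWithin_le_nhds
    rw [mul_zero, add_zero] at hlim
    exact ge_of_tendsto hlim (eventually_nhdsWithin_of_forall hε)
  have hsplit : (c : EReal) = (r₀ : EReal) + ((c - r₀ : ℝ) : EReal) := by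
    rw [← EReal.coe_add, add_sub_cancel]
  rw [hsplit, outerObj, ← hr₀]
  exact add_le_add le_rfl (le_iInf₂ fun d hd => EReal.coe_le_coe_iff.2 (key d hd))

/-- If prices `π` support the social cost of an optimal plan, then this plan, the prices `π` and
suitable edge weights form a saddle point. -/
theorem exists_isSaddlePointOn {z : Plan V m} (hz : z ∈ M.planSet) (hbal : M.IsBalanced z)
    {π : Prices V m q} (hπ : π ∈ M.priceSet)
    (hle : ∀ z' ∈ M.planSet, M.cost z ≤ M.cost z' + M.pairing π z') :
    ∃ t ∈ M.weights, IsSaddlePointOn M.planSet M.dualSet M.saddleFun z (π, t) := by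
  obtain ⟨t, ht, heq, htan⟩ := M.exists_tangent_weights (M.total_nonneg hz.1)
  refine ⟨t, ht, fun z' hz' ξ hξ => ?_⟩
  have h1 : M.saddleFun z ξ ≤ M.cost z := by
    have h2 := hbal.pairing_nonpos hξ.1
    have h3 := M.innerObj_le_Φ (M.total_nonneg hz.1) hξ.2
    rw [saddleFun_eq, cost]
    linarith
  refine h1.trans ?_
  obtain ⟨ρ, hρ, hρle⟩ := htan (total z'.1) (M.total_nonneg hz'.1)
  have hz_le : M.saddleFun z (π, t) ≤ M.cost z := by
    have h2 := hbal.pairing_nonpos hπ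
    rw [saddleFun_eq, cost, ← heq]
    linarith
  -- Optimality of `z` is tested at `(1 - ε) z + ε z'`. There `Φ` is replaced by `innerObj · t` up
  -- to `ε * ρ ε`, convexity is applied, and the inequality is divided by `ε`.
  refine ge_of_tendsto (f := fun ε => M.saddleFun z' (π, t) + ρ ε) (x := 𝓝[Set.Ioc 0 1] 0)
    (by simpa using hρ.const_add (M.saddleFun z' (π, t)))
    (eventually_nhdsWithin_of_forall fun ε hε => ?_)
  have hmem := M.convex_planSet hz hz' (sub_nonneg.2 hε.2) hε.1.le (sub_add_cancel 1 ε)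
  have h2 := hle _ hmem
  have h3 := (M.convexOn_saddleFun (π, t)).2 hz hz' (sub_nonneg.2 hε.2) hε.1.le (sub_add_cancel 1 ε)
  have h4 := hρle ε hε
  have h5 := M.saddleFun_eq ((1 - ε) • z + ε • z') (π, t)
  simp only [smul_eq_mul] at h3
  simp only [cost, Prod.fst_add, Prod.smul_fst, total_combo] at h2 h5
  have h6 := mul_le_mul_of_nonneg_left hz_le (sub_nonneg.2 hε.2)
  have h7 : 0 ≤ ε * (M.saddleFun z' (π, t) + ρ ε - M.cost z) := by
    simp only [cost] at h6 ⊢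
    linarith
  have := nonneg_of_mul_nonneg_right h7 hε.1
  linarith

end NetworkMarket

/-! ### Strong duality and the theorem -/

theorem mainTheorem6 {V E : Type*} [Fintype V] [DecidableEq V] [Fintype E] [DecidableEq E]
    {m q r : ℕ} (M : NetworkMarket V E m q r)
    (hprod : ∃ L W : V → Fin m → ℝ, M.IsProductivePlan L W ∧ M.IsShippable L W)
    (hU : 0 < M.γ → ∀ w ∈ M.OD, ∃ L ∈ M.U w.1, L ≠ 0) :
    -- a full competitive equilibrium exists
    (∃ x d L W π, M.IsFullEquilibrium x d L W π) ∧
    -- the saddle-point problem is convex in the minimized, concave in the maximized variables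
    (∀ ξ ∈ M.dualSet, ConvexOn ℝ M.planSet (fun z => M.saddleFun z ξ)) ∧
    (∀ z ∈ M.planSet, ConcaveOn ℝ M.dualSet (fun ξ => M.saddleFun z ξ)) ∧
    -- it has a solution, and every solution is part of a saddle point
    (∃ π, M.IsOuterSolution π) ∧
    (∀ π, M.IsOuterSolution π → ∃ z ∈ M.planSet, ∃ t ∈ M.weights,
      IsSaddlePointOn M.planSet M.dualSet M.saddleFun z (π, t)) ∧
    -- the inner problem is the potential of the transport subproblem, and is attained
    (∀ s : V × V → ℝ, (∀ w ∈ M.OD, 0 ≤ s w) →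
      M.innerMax s = M.Φ s ∧ ∃ t ∈ M.weights, IsMaxOn (M.innerObj s) M.weights t) ∧
    -- every saddle point yields a full competitive equilibrium: the prices and the plan of the
    -- saddle point, with any minimizer of the Beckmann function as the route flows
    (∀ z ∈ M.planSet, ∀ ξ ∈ M.dualSet,
      IsSaddlePointOn M.planSet M.dualSet M.saddleFun z ξ →
        (∃ x ∈ M.routeFlows (NetworkMarket.total z.1),
          IsMinOn M.Ψ (M.routeFlows (NetworkMarket.total z.1)) x) ∧
        ∀ x ∈ M.routeFlows (NetworkMarket.total z.1),
          IsMinOn M.Ψ (M.routeFlows (NetworkMarket.total z.1)) x →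
            M.IsFullEquilibrium x z.1 z.2.1.2 z.2.2.2 ξ.1) := by
  obtain ⟨L, W, hp, hs⟩ := hprod
  have hUne : ∀ i ∈ M.O, (M.U i).Nonempty := fun i hi => ⟨_, hp.mem_U i hi⟩
  have hV : ∀ j ∈ M.D, (M.consumptionSet j).Nonempty := fun j hj => ⟨_, hp.mem_V j hj⟩
  obtain ⟨d, hd, hout, hin⟩ := hp.exists_shipment hs
  obtain ⟨z, hz, hbal, hmin⟩ := M.exists_optimal_plan hV
    ⟨_, (M.mem_restrictedPlans_of_outflow_le hd hp.mem_U hp.mem_V hout).1,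
      fun i hi => sub_nonpos.2 (hout i hi), fun j hj => sub_nonpos.2 fun k => (hin j hj k).le,
      sub_nonpos.2 fun k => (hp.materials k).le⟩
  obtain ⟨π₀, hπ₀, hle⟩ := M.exists_prices hp hs hU hmin
  have hval := M.le_outerObj hUne hV hle
  -- Together with `hval` this is strong duality: the dual value is the finite number `cost z`,
  -- attained at `π₀`.
  have hupper : ∀ π ∈ M.priceSet, M.outerObj π ≤ (M.cost z : EReal) := fun π hπ =>
    (M.outerObj_le hπ hz).trans (EReal.coe_le_coe_iff.2
      (add_le_of_nonpos_right (hbal.pairing_nonpos hπ)))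
  have hsol : M.IsOuterSolution π₀ := ⟨hπ₀, fun π hπ => (hupper π hπ).trans hval⟩
  have hsaddle : ∀ π, M.IsOuterSolution π → ∃ z ∈ M.planSet, ∃ t ∈ M.weights,
      IsSaddlePointOn M.planSet M.dualSet M.saddleFun z (π, t) := by
    intro π hπ
    -- Any other outer solution attains the same value, so weak duality makes it support the same
    -- optimal plan `z`.
    have hval' : (M.cost z : EReal) ≤ M.outerObj π := hval.trans (hπ.2 hπ₀)
    exact ⟨z, hz, M.exists_isSaddlePointOn hz hbal hπ.1 fun z' hz' =>
      EReal.coe_le_coe_iff.1 (hval'.trans (M.outerObj_le hπ.1 hz'))⟩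
  have heq : ∀ z ∈ M.planSet, ∀ ξ ∈ M.dualSet,
      IsSaddlePointOn M.planSet M.dualSet M.saddleFun z ξ →
        (∃ x ∈ M.routeFlows (NetworkMarket.total z.1),
          IsMinOn M.Ψ (M.routeFlows (NetworkMarket.total z.1)) x) ∧
        ∀ x ∈ M.routeFlows (NetworkMarket.total z.1),
          IsMinOn M.Ψ (M.routeFlows (NetworkMarket.total z.1)) x →
            M.IsFullEquilibrium x z.1 z.2.1.2 z.2.2.2 ξ.1 := fun z hz ξ hξ h =>
    ⟨M.exists_isMinOn_Ψ (M.total_nonneg hz.1), fun x hx hx' =>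
      ⟨M.isCompetitiveEquilibrium_of_isSaddlePointOn hz hξ h, M.isNashWardrop_of_isMinOn hx hx'⟩⟩
  refine ⟨?_, fun ξ _ => M.convexOn_saddleFun ξ, fun z hz => M.concaveOn_saddleFun hz, ⟨π₀, hsol⟩,
    hsaddle, fun s hs => ⟨M.innerMax_eq hs, ?_⟩, heq⟩
  · obtain ⟨z', hz', t, ht, h⟩ := hsaddle π₀ hsol
    obtain ⟨⟨x, hx, hx'⟩, h'⟩ := heq z' hz' (π₀, t) ⟨hπ₀, ht⟩ h
    exact ⟨x, _, _, _, _, h' x hx hx'⟩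
  · obtain ⟨t, ht, h⟩ := M.exists_innerObj_eq hs
    exact ⟨t, ht, fun u hu => (M.innerObj_le_Φ hs hu).trans_eq h.symm⟩
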